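/- Let $M$ be a smooth surface and let $\mathcal{A}\subset TM\setminus 0$ be a non-empty open set, invariant under $y\mapsto\lambda y$ ($\lambda>0$), which projects onto $M$. Let $F:\mathcal{A}\to\mathbb{R}$ be a conic pseudo-Finsler metric: $F$ is smooth, $F(x,\lambda y)=\lambda F(x,y)$ for $\lambda>0$, and in local coordinates $(x^i,y^i)$ the matrix $g_{ij}=\tfrac12\dot\partial_i\dot\partial_jF^2$ is non-degenerate on $\mathcal{A}$, where $\partial_i=\partial/\partial x^i$ and $\dot\partial_i=\partial/\partial y^i$. The geodesic spray coefficients of $F$ are $G^i=\tfrac14g^{il}(y^k\partial_k\dot\partial_lF^2-\partial_lF^2)$. $F$ is of Berwald type if $\dot\partial_j\dot\partial_k\dot\partial_rG^i=0$ on $\mathcal{A}$, and of Douglas type if $\dot\partial_j\dot\partial_k\dot\partial_r\big(G^i-\tfrac13(\dot\partial_sG^s)y^i\big)=0$ on $\mathcal{A}$. Put $\mathfrak{g}=\det(g_{ij})$, $\varepsilon=\operatorname{sgn}\mathfrak{g}$, $\ell_i=\dot\partial_iF$, $\ell^i=y^i/F$, $(m^1,m^2)=\frac{\varepsilon}{\sqrt{\varepsilon\mathfrak{g}}}(-\ell_2,\ell_1)$,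 and let $\mathcal{I}=\varepsilon F\,C_{ijk}m^im^jm^k$ with $C_{ijk}=\tfrac12\dot\partial_kg_{ij}$ be the main scalar. For a function $f$ on $\mathcal{A}$ let $\delta_if=\partial_if-(\dot\partial_iG^j)\dot\partial_jf$ and $$f_{;2}=\varepsilon F(\dot\partial_if)m^i,\qquad f_{,1}=(\delta_if)\ell^i,\qquad f_{,2}=\varepsilon(\delta_if)m^i.$$ Let $\phi:\mathcal{A}\to\mathbb{R}$ be smooth with $\phi(x,\lambda y)=\phi(x,y)$ for $\lambda>0$ and $F^2\big(\dot\partial_i\dot\partial_j\phi+(\dot\partial_i\phi)(\dot\partial_j\phi)\big)m^im^j+\varepsilon\neq0$ on $\mathcal{A}$, and let $\overline F=e^{\phi}F$ be the anisotropic conformal change of $F$. Put $\sigma=\phi_{;2;2}+\varepsilon\mathcal{I}\phi_{;2}+2(\phi_{;2})^2$, $\rho=1/(\sigma+\varepsilon-(\phi_{;2})^2)$ and $$2Q=\varepsilon\rho F^2(\phi_{;2}\phi_{,1}+\phi_{,1;2}-2\phi_{,2}),\qquad 2P=-\rho F^2\phi_{;2}(\phi_{;2}\phi_{,1}+\phi_{,1;2}-2\phi_{,2})+F^2\phi_{,1},$$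 and define $\psi,\chi$ by $$F^2\psi=(-3+\mathcal{I}_{;2})\varepsilon Q+(1+\mathcal{I}_{;2}+2\varepsilon\mathcal{I}^2)\varepsilon P_{;2}+P_{;2;2;2}-3Q_{;2;2}+3\varepsilon\mathcal{I}P_{;2;2}-3\varepsilon\mathcal{I}Q_{;2}+2\mathcal{I}P,$$ $$F^2\chi=3P-(\mathcal{I}+\varepsilon\mathcal{I}_{;2;2}+\mathcal{I}\mathcal{I}_{;2})Q-(2\varepsilon\mathcal{I}_{;2}+\mathcal{I}^2-\varepsilon)Q_{;2}+3\varepsilon P_{;2;2}+Q_{;2;2;2}+3\mathcal{I}P_{;2}.$$ Theorem. If $F$ is of Berwald type, then $\overline F$ is of Douglas type if and only if $$3\psi=\varepsilon\chi_{;2}+2\,\mathcal{I}\chi$$ on $\mathcal{A}$, in all local coordinates. -/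

import Mathlib

open scoped Manifold ContDiff

noncomputable section

namespace FinslerSurface

/-- The coordinate plane, in which both base coordinates `x` and fibre coordinates `y` live. -/
abbrev Plane := EuclideanSpace ℝ (Fin 2)

/-! ### Objects in local coordinates `(x, y)` of the tangent bundle of a surface

A function of `(x, y)` is a function on `Plane × Plane`.  All the functions below are meant at the
points of an open set on which `F` is smooth; the derivatives there do not see values elsewhere. -/

/-- The partial derivative `∂_i f = ∂f/∂x^i`. -/
def dx (i : Fin 2) (f : Plane × Plane → ℝ) (p : Plane × Plane) : ℝ :=
  fderiv ℝ f p (EuclideanSpace.single i 1, 0)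

/-- The partial derivative `∂̇_i f = ∂f/∂y^i`. -/
def dy (i : Fin 2) (f : Plane × Plane → ℝ) (p : Plane × Plane) : ℝ :=
  fderiv ℝ f p (0, EuclideanSpace.single i 1)

/-- The Lagrangian `L = F²`. -/
def lagrangian (F : Plane × Plane → ℝ) (p : Plane × Plane) : ℝ := F p ^ 2

/-- The Finsler metric tensor `g_ij = ½ ∂̇_i ∂̇_j F²`. -/
def metric (F : Plane × Plane → ℝ) (p : Plane × Plane) : Matrix (Fin 2) (Fin 2) ℝ :=
  Matrix.of fun i j => (1 / 2) * dy i (dy j (lagrangian F)) p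

/-- `𝔤 = det (g_ij)`. -/
def detMetric (F : Plane × Plane → ℝ) (p : Plane × Plane) : ℝ := (metric F p).det

/-- The signature `ε = ±1` of the metric: the sign of `𝔤`. -/
def eps (F : Plane × Plane → ℝ) (p : Plane × Plane) : ℝ := Real.sign (detMetric F p)

/-- The geodesic spray coefficients
`G^i = ¼ g^{il} (y^k ∂_k ∂̇_l F² - ∂_l F²)`, the spray being `y^i ∂_i - 2 G^i ∂̇_i`. -/
def spray (F : Plane × Plane → ℝ) (i : Fin 2) (p : Plane × Plane) : ℝ :=
  (1 / 4) * ∑ l, (metric F p)⁻¹ i l *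
    ((∑ k, p.2 k * dx k (dy l (lagrangian F)) p) - dx l (lagrangian F) p)

/-- The Barthel connection `G^i_j = ∂̇_j G^i`. -/
def barthel (F : Plane × Plane → ℝ) (i j : Fin 2) : Plane × Plane → ℝ := dy j (spray F i)

/-- The Berwald connection `G^i_{jk} = ∂̇_k G^i_j`. -/
def berwaldConnection (F : Plane × Plane → ℝ) (i j k : Fin 2) : Plane × Plane → ℝ :=
  dy k (barthel F i j)

/-- The Berwald curvature `G^i_{jkr} = ∂̇_r G^i_{jk}`. -/
def berwaldCurvature (F : Plane × Plane → ℝ) (i j k r : Fin 2) : Plane × Plane → ℝ :=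
  dy r (berwaldConnection F i j k)

/-- The Douglas tensor in dimension `n = 2`:
`D^i_{jkr} = ∂̇_r ∂̇_k ∂̇_j (G^i - (1 / (n + 1)) (∂̇_s G^s) y^i)`. -/
def douglasTensor (F : Plane × Plane → ℝ) (i j k r : Fin 2) : Plane × Plane → ℝ :=
  dy r (dy k (dy j fun q => spray F i q - (1 / 3) * (∑ s, barthel F s s q) * q.2 i))

/-- `ℓ_i = ∂̇_i F`. -/
def ellLow (F : Plane × Plane → ℝ) (i : Fin 2) : Plane × Plane → ℝ := dy i F

/-- `ℓ^i = y^i / F`. -/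
def ellUp (F : Plane × Plane → ℝ) (i : Fin 2) (p : Plane × Plane) : ℝ := p.2 i / F p

/-- The second vector of the modified Berwald frame,
`(m^1, m^2) = (ε / √(ε 𝔤)) (-ℓ_2, ℓ_1)`. -/
def mUp (F : Plane × Plane → ℝ) (i : Fin 2) (p : Plane × Plane) : ℝ :=
  eps F p / Real.sqrt (eps F p * detMetric F p) * ![-ellLow F 1 p, ellLow F 0 p] i

/-- The Cartan tensor `C_ijk = ½ ∂̇_k g_ij`. -/
def cartan (F : Plane × Plane → ℝ) (i j k : Fin 2) (p : Plane × Plane) : ℝ :=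
  (1 / 2) * dy k (fun q => metric F q i j) p

/-- The main scalar `𝓘`, given by `F C_ijk = 𝓘 m_i m_j m_k`; as `m^i m_i = ε` this is
`𝓘 = ε F C_ijk m^i m^j m^k`. -/
def mainScalar (F : Plane × Plane → ℝ) (p : Plane × Plane) : ℝ :=
  eps F p * F p * ∑ i, ∑ j, ∑ k, cartan F i j k p * mUp F i p * mUp F j p * mUp F k p

/-- The vertical scalar derivative `f_{;2} = ε F (∂̇_i f) m^i`. -/
def v2 (F f : Plane × Plane → ℝ) (p : Plane × Plane) : ℝ :=
  eps F p * F p * ∑ i, dy i f p * mUp F i p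

/-- The horizontal derivative `δ_i f = ∂_i f - G^j_i ∂̇_j f`. -/
def delta (F : Plane × Plane → ℝ) (i : Fin 2) (f : Plane × Plane → ℝ) (p : Plane × Plane) : ℝ :=
  dx i f p - ∑ j, barthel F j i p * dy j f p

/-- The horizontal scalar derivative `f_{,1} = (δ_i f) ℓ^i`. -/
def h1 (F f : Plane × Plane → ℝ) (p : Plane × Plane) : ℝ :=
  ∑ i, delta F i f p * ellUp F i p

/-- The horizontal scalar derivative `f_{,2} = ε (δ_i f) m^i`. -/
def h2 (F f : Plane × Plane → ℝ) (p : Plane × Plane) : ℝ :=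
  eps F p * ∑ i, delta F i f p * mUp F i p

/-- `σ = φ_{;2;2} + ε 𝓘 φ_{;2} + 2 (φ_{;2})²`. -/
def sigma (F φ : Plane × Plane → ℝ) (p : Plane × Plane) : ℝ :=
  v2 F (v2 F φ) p + eps F p * mainScalar F p * v2 F φ p + 2 * v2 F φ p ^ 2

/-- `ρ = 1 / (σ + ε - (φ_{;2})²)`. -/
def rho (F φ : Plane × Plane → ℝ) (p : Plane × Plane) : ℝ :=
  1 / (sigma F φ p + eps F p - v2 F φ p ^ 2)

/-- `Q`, with `2 Q = ε ρ F² (φ_{;2} φ_{,1} + φ_{,1;2} - 2 φ_{,2})`. -/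
def Q (F φ : Plane × Plane → ℝ) (p : Plane × Plane) : ℝ :=
  (1 / 2) * (eps F p * rho F φ p * F p ^ 2 *
    (v2 F φ p * h1 F φ p + v2 F (h1 F φ) p - 2 * h2 F φ p))

/-- `P`, with `2 P = -ρ F² φ_{;2} (φ_{;2} φ_{,1} + φ_{,1;2} - 2 φ_{,2}) + F² φ_{,1}`. -/
def P (F φ : Plane × Plane → ℝ) (p : Plane × Plane) : ℝ :=
  (1 / 2) * (-rho F φ p * F p ^ 2 * v2 F φ p *
    (v2 F φ p * h1 F φ p + v2 F (h1 F φ) p - 2 * h2 F φ p) + F p ^ 2 * h1 F φ p)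

/-- The function `ψ`, with
`F² ψ = (-3 + 𝓘_{;2}) ε Q + (1 + 𝓘_{;2} + 2 ε 𝓘²) ε P_{;2} + P_{;2;2;2} - 3 Q_{;2;2}
  + 3 ε 𝓘 P_{;2;2} - 3 ε 𝓘 Q_{;2} + 2 𝓘 P`. -/
def psi (F φ : Plane × Plane → ℝ) (p : Plane × Plane) : ℝ :=
  ((-3 + v2 F (mainScalar F) p) * eps F p * Q F φ p
    + (1 + v2 F (mainScalar F) p + 2 * eps F p * mainScalar F p ^ 2) * eps F p * v2 F (P F φ) p
    + v2 F (v2 F (v2 F (P F φ))) p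
    - 3 * v2 F (v2 F (Q F φ)) p
    + 3 * eps F p * mainScalar F p * v2 F (v2 F (P F φ)) p
    - 3 * eps F p * mainScalar F p * v2 F (Q F φ) p
    + 2 * mainScalar F p * P F φ p) / F p ^ 2

/-- The function `χ`, with
`F² χ = 3 P - (𝓘 + ε 𝓘_{;2;2} + 𝓘 𝓘_{;2}) Q - (2 ε 𝓘_{;2} + 𝓘² - ε) Q_{;2} + 3 ε P_{;2;2}
  + Q_{;2;2;2} + 3 𝓘 P_{;2}`. -/
def chi (F φ : Plane × Plane → ℝ) (p : Plane × Plane) : ℝ :=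
  (3 * P F φ p
    - (mainScalar F p + eps F p * v2 F (v2 F (mainScalar F)) p
        + mainScalar F p * v2 F (mainScalar F) p) * Q F φ p
    - (2 * eps F p * v2 F (mainScalar F) p + mainScalar F p ^ 2 - eps F p) * v2 F (Q F φ) p
    + 3 * eps F p * v2 F (v2 F (P F φ)) p
    + v2 F (v2 F (v2 F (Q F φ))) p
    + 3 * mainScalar F p * v2 F (P F φ) p) / F p ^ 2

/-! ### Conic pseudo-Finsler metrics on a smooth surface -/

section Surface

variable {M : Type*} [TopologicalSpace M] [ChartedSpace Plane M] [IsManifold (𝓡 2) ∞ M]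

/-- The tangent vector of `M` with coordinates `(x, y)` in the chart `e`. -/
def ofCoord (e : OpenPartialHomeomorph M Plane) (p : Plane × Plane) : TangentBundle (𝓡 2) M :=
  tangentMap (𝓡 2) (𝓡 2) e.symm ⟨p.1, p.2⟩

/-- A function on the tangent bundle, in the coordinates `(x, y)` induced by the chart `e`. -/
def coordRep (e : OpenPartialHomeomorph M Plane) (f : TangentBundle (𝓡 2) M → ℝ)
    (p : Plane × Plane) : ℝ :=
  f (ofCoord e p)

/-- The coordinates `(x, y)` of the points of `A` over the domain of the chart `e`. -/
def coordDomain (e : OpenPartialHomeomorph M Plane) (A : Set (TangentBundle (𝓡 2) M)) :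
    Set (Plane × Plane) :=
  {p | p.1 ∈ e.target ∧ ofCoord e p ∈ A}

/-- `A` is a conic sub-bundle of `TM`: a non-empty open set of non-zero tangent vectors,
invariant under positive scaling, that projects onto `M`. -/
structure IsConicSubbundle (A : Set (TangentBundle (𝓡 2) M)) : Prop where
  nonempty : A.Nonempty
  isOpen : IsOpen A
  ne_zero : ∀ v ∈ A, v.snd ≠ 0
  smul_mem : ∀ v ∈ A, ∀ c : ℝ, 0 < c → (⟨v.proj, c • v.snd⟩ : TangentBundle (𝓡 2) M) ∈ A
  proj_surj : ∀ x : M, ∃ v ∈ A, v.proj = x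

/-- `f` is positively homogeneous of degree `r` in the directional argument, on `A`. -/
def IsHomogeneousOn (A : Set (TangentBundle (𝓡 2) M)) (r : ℕ) (f : TangentBundle (𝓡 2) M → ℝ) :
    Prop :=
  ∀ v ∈ A, ∀ c : ℝ, 0 < c → f ⟨v.proj, c • v.snd⟩ = c ^ r * f v

/-- `F` (of which only the restriction to `A` matters) is a conic pseudo-Finsler metric. -/
structure IsConicPseudoFinsler (A : Set (TangentBundle (𝓡 2) M))
    (F : TangentBundle (𝓡 2) M → ℝ) : Prop where
  conic : IsConicSubbundle A
  smooth : ContMDiffOn (𝓡 2).tangent 𝓘(ℝ, ℝ) ∞ F A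
  homogeneous : IsHomogeneousOn A 1 F
  nondegenerate : ∀ e ∈ IsManifold.maximalAtlas (𝓡 2) ∞ M, ∀ p ∈ coordDomain e A,
    detMetric (coordRep e F) p ≠ 0

/-- `F` is of Berwald type: its Berwald curvature vanishes identically. -/
def IsBerwald (A : Set (TangentBundle (𝓡 2) M)) (F : TangentBundle (𝓡 2) M → ℝ) : Prop :=
  ∀ e ∈ IsManifold.maximalAtlas (𝓡 2) ∞ M, ∀ p ∈ coordDomain e A,
    ∀ i j k r, berwaldCurvature (coordRep e F) i j k r p = 0

/-- `F` is of Douglas type: its Douglas tensor vanishes identically. -/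
def IsDouglas (A : Set (TangentBundle (𝓡 2) M)) (F : TangentBundle (𝓡 2) M → ℝ) : Prop :=
  ∀ e ∈ IsManifold.maximalAtlas (𝓡 2) ∞ M, ∀ p ∈ coordDomain e A,
    ∀ i j k r, douglasTensor (coordRep e F) i j k r p = 0

/-- `φ` is an admissible factor of an anisotropic conformal change of `F`: smooth, homogeneous of
degree `0`, with `F² (∂̇_i ∂̇_j φ + (∂̇_i φ)(∂̇_j φ)) m^i m^j + ε ≠ 0`. -/
structure IsAnisotropicConformalFactor (A : Set (TangentBundle (𝓡 2) M))
    (F φ : TangentBundle (𝓡 2) M → ℝ) : Prop where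
  smooth : ContMDiffOn (𝓡 2).tangent 𝓘(ℝ, ℝ) ∞ φ A
  homogeneous : IsHomogeneousOn A 0 φ
  nondegenerate : ∀ e ∈ IsManifold.maximalAtlas (𝓡 2) ∞ M, ∀ p ∈ coordDomain e A,
    coordRep e F p ^ 2 * (∑ i, ∑ j,
        (dy i (dy j (coordRep e φ)) p + dy i (coordRep e φ) p * dy j (coordRep e φ) p)
          * mUp (coordRep e F) i p * mUp (coordRep e F) j p)
      + eps (coordRep e F) p ≠ 0

/-- The anisotropic conformal change `F̄ = e^φ F`. -/
def conformalChange (φ F : TangentBundle (𝓡 2) M → ℝ) (v : TangentBundle (𝓡 2) M) : ℝ :=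
  Real.exp (φ v) * F v

end Surface

end FinslerSurface

end

/-!
All objects are local, so fix a chart and work on the open cone `U` of the coordinates `(x, y)` of
the points of `A`. The equivalence holds at each point of `U` separately.

*Dimension two.* A fibre tensor that annihilates `y` in every slot is a multiple of a power of
`ω = (-y¹, y⁰)`. Hence `∂̇_i ∂̇_j F = h ω_i ω_j` with `𝔤 = F³ h`, and the same holds for
`F̄ = e^φ F`, with `h̄ = e^φ ε 𝔤 / (ρ F³)` (`hasHessian_of_det`, `hasHessian_conformal`). Note that
`F ≠ 0` on `A`, as `𝔤` vanishes with `F`, while negative values of `F` are allowed.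

*The change of spray.* `2 G^k ∂̇_k ∂̇_l F = y^k ∂_k ∂̇_l F - ∂_l F` (`IsSpray.geodesic`), and
likewise for `F̄`. Contracting the difference with `m^l` gives
`Ω := y ∧ (Ḡ - G) = ε F Q / √(ε 𝔤)` (`wedge_spray_conformal`); the component `P` along `y` plays
no role.

*The Douglas tensor.* `G^i - ⅓ (∂̇_s G^s) y^i` is divergence free with stream function `⅓ y ∧ G`
(`projective_eq`), so the Douglas tensor of `F̄` consists of the fourth fibre derivatives of
`y ∧ Ḡ`. For a Berwald metric `G` is quadratic in `y` and contributes nothing, so only those of `Ω`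
remain
(`third_projective_eq`). As `Ω` is homogeneous of degree `3`, they are all multiples of the single
contraction `Ω_ijkl v^i v^j v^k v^l`, where `v^i = y^i_{;2} = ε F m^i` (`wedge_pow_mul_fourth`).

*The scalar equation.* Write `D` for the derivative `_{;2}`. From `D v^i = -ε y^i - ε 𝓘 v^i` and
`D √(ε 𝔤) = ε 𝓘 √(ε 𝔤)` the contraction is a fourth order operator in `D` applied to `Q`
(`quartic_eq`), and this operator is `ε χ_{;2} + 2 𝓘 χ - 3 ψ` up to a factor without zeros, all
terms in `P` cancelling in the latter (`quartic_eq_psi_chi`).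

The computations are carried out in an abstract commutative ring with derivations `∂_i`, `∂̇_i`
(`TangentCalculus`), and applied to the ring of smooth functions on `U` (`calculus`).
-/

noncomputable section

namespace FinslerSurface

/-! ### Homogeneous functions and their fibre derivatives -/

/-- The partial derivatives `X i = ∂_i`, `Y i = ∂̇_i` and the fibre coordinates `y i`, abstractly:
commuting derivations of a commutative ring. -/
structure TangentCalculus (R : Type*) [CommRing R] [Algebra ℝ R] where
  X : Fin 2 → Derivation ℝ R R
  Y : Fin 2 → Derivation ℝ R R
  y : Fin 2 → R
  X_Y : ∀ i j a, X i (Y j a) = Y j (X i a)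
  Y_Y : ∀ i j a, Y i (Y j a) = Y j (Y i a)
  Y_y : ∀ i j, Y i (y j) = if i = j then 1 else 0
  X_y : ∀ i j, X i (y j) = 0

namespace TangentCalculus

variable {R : Type*} [CommRing R] [Algebra ℝ R] (T : TangentCalculus R)

/-- Euler's relation `y^i ∂̇_i a = n a` for a function that is homogeneous of degree `n` in `y`. -/
def IsHomog (n : ℤ) (a : R) : Prop := T.y 0 * T.Y 0 a + T.y 1 * T.Y 1 a = n * a

lemma Y0_y0 : T.Y 0 (T.y 0) = 1 := by simp [T.Y_y]
lemma Y1_y1 : T.Y 1 (T.y 1) = 1 := by simp [T.Y_y]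
lemma Y0_y1 : T.Y 0 (T.y 1) = 0 := by simp [T.Y_y]
lemma Y1_y0 : T.Y 1 (T.y 0) = 0 := by simp [T.Y_y]
lemma Y1_Y0 (a : R) : T.Y 1 (T.Y 0 a) = T.Y 0 (T.Y 1 a) := T.Y_Y 1 0 a

lemma deriv_ofNat (d : Derivation ℝ R R) (n : ℕ) [n.AtLeastTwo] : d (ofNat(n) : R) = 0 :=
  d.map_natCast n

lemma two_mul_cancel {a b : R} (h : 2 * a = 2 * b) : a = b := by
  have h2 : algebraMap ℝ R (1 / 2) * 2 = 1 := by
    rw [← map_ofNat (algebraMap ℝ R) 2, ← map_mul]; norm_num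
  linear_combination algebraMap ℝ R (1 / 2) * h - (a - b) * h2

variable {T}

lemma IsHomog.Y {n : ℤ} {a : R} (h : T.IsHomog n a) (i : Fin 2) :
    T.IsHomog (n - 1) (T.Y i a) := by
  have h' := congrArg (T.Y i) h
  unfold IsHomog at *
  rw [Derivation.leibniz (T.Y i) (n : R), Derivation.map_intCast] at h'
  fin_cases i <;>
  · simp [Derivation.leibniz, T.Y0_y0, T.Y1_y1, T.Y0_y1, T.Y1_y0, T.Y1_Y0] at h' ⊢
    linear_combination h'

omit [Algebra ℝ R] in
/-- A tensor annihilated by `y` is a multiple of `(-y¹, y⁰)`; the multiple is found by contracting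
with a vector `v` transverse to `y`. -/
lemma wedge_mul_of_contract_eq_zero {y₀ y₁ t₀ t₁ : R} (v₀ v₁ : R) (h : y₀ * t₀ + y₁ * t₁ = 0) :
    (y₀ * v₁ - y₁ * v₀) * t₀ = -y₁ * (v₀ * t₀ + v₁ * t₁) ∧
      (y₀ * v₁ - y₁ * v₀) * t₁ = y₀ * (v₀ * t₀ + v₁ * t₁) :=
  ⟨by linear_combination v₁ * h, by linear_combination -v₀ * h⟩

/-- The covector `ω = (-y¹, y⁰)`, which annihilates `y`. -/
def om (T : TangentCalculus R) : Fin 2 → R := ![-T.y 1, T.y 0]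

lemma IsHomog.wedge_mul_Y {a : R} (h : T.IsHomog 0 a) (v₀ v₁ : R) (i : Fin 2) :
    (T.y 0 * v₁ - T.y 1 * v₀) * T.Y i a = T.om i * (v₀ * T.Y 0 a + v₁ * T.Y 1 a) := by
  have h' : T.y 0 * T.Y 0 a + T.y 1 * T.Y 1 a = 0 := by rw [h]; simp
  have := wedge_mul_of_contract_eq_zero v₀ v₁ h'
  fin_cases i
  · simpa [om] using this.1
  · simpa [om] using this.2

/-- `F` is homogeneous of degree `1` and its fibre Hessian, which then annihilates `y`, is the
rank-one form `h ω ⊗ ω`, `ω = (-y¹, y⁰)`. -/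
structure HasHessian (T : TangentCalculus R) (F h : R) : Prop where
  homog : T.IsHomog 1 F
  h00 : T.Y 0 (T.Y 0 F) = h * T.y 1 ^ 2
  h01 : T.Y 0 (T.Y 1 F) = -(h * (T.y 0 * T.y 1))
  h11 : T.Y 1 (T.Y 1 F) = h * T.y 0 ^ 2

lemma HasHessian.euler {F h : R} (H : T.HasHessian F h) :
    T.y 0 * T.Y 0 F + T.y 1 * T.Y 1 F = F := by
  simpa [IsHomog] using H.homog

/-- The Hessian of a function of degree `1` is recovered from its value `k` on a vector `n` with
`y ∧ n = f` invertible. -/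
lemma HasHessian.of_contract {F k n₀ n₁ f fi : R} (hF : T.IsHomog 1 F) (hf : f * fi = 1)
    (hw : T.y 0 * n₁ - T.y 1 * n₀ = f)
    (hk : n₀ ^ 2 * T.Y 0 (T.Y 0 F) + 2 * (n₀ * n₁) * T.Y 0 (T.Y 1 F)
      + n₁ ^ 2 * T.Y 1 (T.Y 1 F) = k) :
    T.HasHessian F (fi ^ 2 * k) := by
  have e0 := hF.Y 0
  have e1 := hF.Y 1
  simp only [IsHomog, sub_self, Int.cast_zero, zero_mul, T.Y1_Y0] at e0 e1
  have hf2 : f ^ 2 * fi ^ 2 = 1 := by rw [← mul_pow, hf, one_pow]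
  have key : f ^ 2 * T.Y 0 (T.Y 0 F) = T.y 1 ^ 2 * k ∧
      f ^ 2 * T.Y 0 (T.Y 1 F) = -(T.y 0 * T.y 1 * k) ∧
      f ^ 2 * T.Y 1 (T.Y 1 F) = T.y 0 ^ 2 * k := by
    subst hk hw
    refine ⟨?_, ?_, ?_⟩
    · linear_combination (T.y 0 * n₁ ^ 2 - 2 * T.y 1 * n₀ * n₁) * e0 - T.y 1 * n₁ ^ 2 * e1
    · linear_combination (T.y 1 * n₀ ^ 2) * e0 + T.y 0 * n₁ ^ 2 * e1
    · linear_combination -(T.y 0 * n₀ ^ 2) * e0 + (T.y 1 * n₀ ^ 2 - 2 * T.y 0 * n₀ * n₁) * e1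
  refine ⟨hF, ?_, ?_, ?_⟩
  · linear_combination fi ^ 2 * key.1 - T.Y 0 (T.Y 0 F) * hf2
  · linear_combination fi ^ 2 * key.2.1 - T.Y 0 (T.Y 1 F) * hf2
  · linear_combination fi ^ 2 * key.2.2 - T.Y 1 (T.Y 1 F) * hf2

/-- The coefficient `h` has degree `-3`, because `∂̇_k ∂̇_i ∂̇_j F` is symmetric. -/
lemma HasHessian.isHomog_coeff {F fi h : R} (H : T.HasHessian F h) (hf : F * fi = 1) :
    T.IsHomog (-3) h := by
  have e := H.euler
  have c0 := T.Y1_Y0 (T.Y 1 F)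
  have c1 := T.Y1_Y0 (T.Y 0 F)
  rw [H.h11, H.h01] at c0
  rw [H.h00, T.Y1_Y0 F, H.h01] at c1
  simp only [Derivation.leibniz, Derivation.leibniz_pow, map_neg, smul_eq_mul, T.Y0_y0, T.Y1_y1,
    T.Y0_y1, T.Y1_y0, nsmul_eq_mul] at c0 c1
  unfold IsHomog
  push_cast at c0 c1 ⊢
  have : F * (T.y 0 * T.Y 0 h + T.y 1 * T.Y 1 h + 3 * h) = 0 := by
    linear_combination T.Y 1 F * c1 - T.Y 0 F * c0
      - (T.y 0 * T.Y 0 h + T.y 1 * T.Y 1 h + 3 * h) * e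
  linear_combination fi * this - (T.y 0 * T.Y 0 h + T.y 1 * T.Y 1 h + 3 * h) * hf

/-- `det (g_ij) = F³ h`, as `g_ij = F ∂̇_i ∂̇_j F + (∂̇_i F) (∂̇_j F)`. -/
lemma HasHessian.det {F h : R} (H : T.HasHessian F h) :
    (F * T.Y 0 (T.Y 0 F) + T.Y 0 F * T.Y 0 F) * (F * T.Y 1 (T.Y 1 F) + T.Y 1 F * T.Y 1 F)
      - (F * T.Y 0 (T.Y 1 F) + T.Y 0 F * T.Y 1 F) ^ 2 = F ^ 3 * h := by
  rw [H.h00, H.h01, H.h11]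
  have e := H.euler
  linear_combination F * h * (T.y 0 * T.Y 0 F + T.y 1 * T.Y 1 F + F) * e

lemma hasHessian_of_det {F fi g : R} (hF : T.IsHomog 1 F) (hf : F * fi = 1)
    (hg : (F * T.Y 0 (T.Y 0 F) + T.Y 0 F * T.Y 0 F) * (F * T.Y 1 (T.Y 1 F) + T.Y 1 F * T.Y 1 F)
      - (F * T.Y 0 (T.Y 1 F) + T.Y 0 F * T.Y 1 F) ^ 2 = g) :
    T.HasHessian F (fi ^ 3 * g) := by
  have e : T.y 0 * T.Y 0 F + T.y 1 * T.Y 1 F = F := by simpa [IsHomog] using hF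
  have h := HasHessian.of_contract (n₀ := -T.Y 1 F) (n₁ := T.Y 0 F) hF hf
    (by linear_combination e) rfl
  have hd := h.det
  rw [hg] at hd
  have hf3 : F ^ 3 * fi ^ 3 = 1 := by rw [← mul_pow, hf, one_pow]
  generalize fi ^ 2 * _ = k at h hd
  have : fi ^ 3 * g = k := by linear_combination fi ^ 3 * hd + k * hf3
  rwa [this]

/-- `G` are the spray coefficients of `F`: twice the fibre Hessian of `F²`, applied to `G`, is
`y^k ∂_k ∂̇_l F² - ∂_l F²`. -/
def IsSpray (T : TangentCalculus R) (F : R) (G : Fin 2 → R) : Prop :=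
  ∀ l, 2 * (T.Y l (T.Y 0 (F * F)) * G 0 + T.Y l (T.Y 1 (F * F)) * G 1)
    = T.y 0 * T.X 0 (T.Y l (F * F)) + T.y 1 * T.X 1 (T.Y l (F * F)) - T.X l (F * F)

section Spray

variable {F fi h hi : R} {G : Fin 2 → R}

/-- `F` is constant along its geodesics: `y^i ∂_i - 2 G^i ∂̇_i` annihilates `F`. -/
lemma IsSpray.horizontal (hG : T.IsSpray F G) (H : T.HasHessian F h) (hf : F * fi = 1) :
    T.y 0 * T.X 0 F + T.y 1 * T.X 1 F = 2 * (T.Y 0 F * G 0 + T.Y 1 F * G 1) := by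
  have g0 := hG 0
  have g1 := hG 1
  have e := H.euler
  have ex0 := congrArg (T.X 0) e
  have ex1 := congrArg (T.X 1) e
  simp only [map_add, Derivation.leibniz, smul_eq_mul, T.X_y, T.Y1_Y0, H.h00, H.h01, H.h11]
    at g0 g1 ex0 ex1
  have e0 : T.y 0 * (h * T.y 1 ^ 2) + T.y 1 * -(h * (T.y 0 * T.y 1)) = 0 := by ring
  apply two_mul_cancel
  have : 2 * (F * (T.y 0 * T.X 0 F + T.y 1 * T.X 1 F))
      = 2 * (F * (2 * (T.Y 0 F * G 0 + T.Y 1 F * G 1))) := by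
    linear_combination -(T.y 0 * g0 + T.y 1 * g1)
      + (4 * (T.Y 0 F * G 0 + T.Y 1 F * G 1) - 2 * (T.y 0 * T.X 0 F + T.y 1 * T.X 1 F)) * e
      - 2 * F * (T.y 0 * ex0 + T.y 1 * ex1)
  linear_combination fi * this - 2 * (T.y 0 * T.X 0 F + T.y 1 * T.X 1 F
    - 2 * (T.Y 0 F * G 0 + T.Y 1 F * G 1)) * hf

/-- The geodesic equation of `F` itself, `y^k ∂_k ∂̇_l F - ∂_l F = 2 G^k ∂̇_k ∂̇_l F`. -/
lemma IsSpray.geodesic (hG : T.IsSpray F G) (H : T.HasHessian F h) (hf : F * fi = 1) (l : Fin 2) :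
    T.y 0 * T.X 0 (T.Y l F) + T.y 1 * T.X 1 (T.Y l F) - T.X l F
      = 2 * (T.Y l (T.Y 0 F) * G 0 + T.Y l (T.Y 1 F) * G 1) := by
  have g := hG l
  have e := hG.horizontal H hf
  simp only [map_add, Derivation.leibniz, smul_eq_mul] at g
  apply two_mul_cancel
  linear_combination -fi * g - 2 * fi * T.Y l F * e
    - 2 * (T.y 0 * T.X 0 (T.Y l F) + T.y 1 * T.X 1 (T.Y l F) - T.X l F
      - 2 * (T.Y l (T.Y 0 F) * G 0 + T.Y l (T.Y 1 F) * G 1)) * hf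

/-- The spray coefficients are homogeneous of degree `2`. -/
lemma IsSpray.isHomog (hG : T.IsSpray F G) (H : T.HasHessian F h) (hf : F * fi = 1)
    (hh : h * hi = 1) (i : Fin 2) : T.IsHomog 2 (G i) := by
  have e := H.euler
  have hor := hG.horizontal H hf
  have g0 := hG.geodesic H hf 0
  have g1 := hG.geodesic H hf 1
  -- Apply `y^i ∂̇_i` to the equations that determine `G`. The result says that
  -- `y^i ∂̇_i G - 2 G` solves the homogeneous system.
  have k0 := congrArg (T.Y 0) hor
  have k1 := congrArg (T.Y 1) hor
  have k00 := congrArg (T.Y 0) g0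
  have k01 := congrArg (T.Y 1) g0
  have k10 := congrArg (T.Y 0) g1
  have k11 := congrArg (T.Y 1) g1
  have ex0 := congrArg (T.X 0) e
  have ex1 := congrArg (T.X 1) e
  have hx : T.y 0 * T.Y 0 h + T.y 1 * T.Y 1 h = -3 * h := by
    simpa [IsHomog] using H.isHomog_coeff hf
  simp only [map_add, map_sub, map_neg, Derivation.leibniz, Derivation.leibniz_pow, smul_eq_mul,
    nsmul_eq_mul, T.X_y, T.Y1_Y0, ← T.X_Y, H.h00, H.h01, H.h11, T.Y0_y0, T.Y1_y1, T.Y0_y1,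
    T.Y1_y0, deriv_ofNat] at g0 g1 k0 k1 k00 k01 k10 k11 ex0 ex1
  push_cast at g0 g1 k0 k1 k00 k01 k10 k11 ex0 ex1
  have z1 : T.Y 0 F * (T.y 0 * T.Y 0 (G 0) + T.y 1 * T.Y 1 (G 0) - 2 * G 0)
      + T.Y 1 F * (T.y 0 * T.Y 0 (G 1) + T.y 1 * T.Y 1 (G 1) - 2 * G 1) = 0 := by
    apply two_mul_cancel
    linear_combination -(T.y 0 * k0 + T.y 1 * k1) + 2 * hor + T.y 0 * ex0 + T.y 1 * ex1
  have z2 : T.y 0 * (T.y 0 * T.Y 0 (G 1) + T.y 1 * T.Y 1 (G 1) - 2 * G 1)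
      - T.y 1 * (T.y 0 * T.Y 0 (G 0) + T.y 1 * T.Y 1 (G 0) - 2 * G 0) = 0 := by
    set z := T.y 0 * (T.y 0 * T.Y 0 (G 1) + T.y 1 * T.Y 1 (G 1) - 2 * G 1)
      - T.y 1 * (T.y 0 * T.Y 0 (G 0) + T.y 1 * T.Y 1 (G 0) - 2 * G 0) with hz
    have w0 : h * T.y 1 * z = 0 := by
      apply two_mul_cancel
      rw [hz]
      linear_combination T.y 0 * k00 + T.y 1 * k01 - g0 + ex0
        + 2 * (T.y 1 ^ 2 * G 0 - T.y 0 * T.y 1 * G 1) * hx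
    have w1 : h * T.y 0 * z = 0 := by
      apply two_mul_cancel
      rw [hz]
      linear_combination -(T.y 0 * k10 + T.y 1 * k11) + g1 - ex1
        + 2 * (T.y 0 * T.y 1 * G 0 - T.y 0 ^ 2 * G 1) * hx
    have w : F * h * z = 0 := by
      linear_combination T.Y 0 F * w1 + T.Y 1 F * w0 - h * z * e
    linear_combination fi * hi * w - z * hh - z * h * hi * hf
  unfold IsHomog
  fin_cases i <;> simp
  · linear_combination fi * (T.y 0 * z1 - T.Y 1 F * z2)
      - (T.y 0 * T.Y 0 (G 0) + T.y 1 * T.Y 1 (G 0) - 2 * G 0) * (hf + fi * e)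
  · linear_combination fi * (T.y 1 * z1 + T.Y 0 F * z2)
      - (T.y 0 * T.Y 0 (G 1) + T.y 1 * T.Y 1 (G 1) - 2 * G 1) * (hf + fi * e)

end Spray

/-! ### The modified Berwald frame and the anisotropic conformal change -/

/-- The data of the modified Berwald frame: `fi = 1 / F`, `e = ε`, `s = √(ε 𝔤)` and `si = 1 / s`.
As `𝔤 = ε s²`, the fibre Hessian of `F` is `(ε s² / F³) ω ⊗ ω`. -/
structure IsFrame (T : TangentCalculus R) (F fi s si e : R) : Prop where
  F_mul : F * fi = 1
  s_mul : s * si = 1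
  e_mul : e * e = 1
  hess : T.HasHessian F (fi ^ 3 * (e * s ^ 2))
  Y_e : ∀ i, T.Y i e = 0

/-- The vector `m^i` of the modified Berwald frame. -/
def mvec (T : TangentCalculus R) (F si e : R) : Fin 2 → R :=
  ![e * si * -T.Y 1 F, e * si * T.Y 0 F]

/-- The vertical scalar derivative `a ↦ a_{;2}`; its two factors `ε` have cancelled. -/
def vert (T : TangentCalculus R) (F si : R) : Derivation ℝ R R :=
  (F * si) • (T.Y 0 F • T.Y 1 - T.Y 1 F • T.Y 0)

lemma vert_apply (F si a : R) :
    T.vert F si a = F * si * (T.Y 0 F * T.Y 1 a - T.Y 1 F * T.Y 0 a) := by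
  simp [vert]

lemma vert_F (F si : R) : T.vert F si F = 0 := by rw [vert_apply]; ring

lemma vert_y0 (F si : R) : T.vert F si (T.y 0) = -(F * si * T.Y 1 F) := by
  rw [vert_apply]; simp [T.Y_y]

lemma vert_y1 (F si : R) : T.vert F si (T.y 1) = F * si * T.Y 0 F := by
  rw [vert_apply]; simp [T.Y_y]

lemma vert_eq (F si a : R) : T.vert F si a
    = T.vert F si (T.y 0) * T.Y 0 a + T.vert F si (T.y 1) * T.Y 1 a := by
  rw [vert_y0, vert_y1, vert_apply]; ring

/-- The horizontal derivative `δ_i`. -/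
def hor (T : TangentCalculus R) (G : Fin 2 → R) (i : Fin 2) (a : R) : R :=
  T.X i a - (T.Y i (G 0) * T.Y 0 a + T.Y i (G 1) * T.Y 1 a)

/-- The horizontal scalar derivative `a ↦ a_{,1}`. -/
def hor1 (T : TangentCalculus R) (fi : R) (G : Fin 2 → R) (a : R) : R :=
  T.hor G 0 a * (T.y 0 * fi) + T.hor G 1 a * (T.y 1 * fi)

/-- The horizontal scalar derivative `a ↦ a_{,2}`. -/
def hor2 (T : TangentCalculus R) (F si e : R) (G : Fin 2 → R) (a : R) : R :=
  e * (T.hor G 0 a * T.mvec F si e 0 + T.hor G 1 a * T.mvec F si e 1)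

/-- The non-degeneracy factor `F² (∂̇_i ∂̇_j φ + (∂̇_i φ)(∂̇_j φ)) m^i m^j + ε`. -/
def nondegFactor (T : TangentCalculus R) (F si e φ : R) : R :=
  F ^ 2 * (∑ i, ∑ j, (T.Y i (T.Y j φ) + T.Y i φ * T.Y j φ) * T.mvec F si e i * T.mvec F si e j) + e

/-- Four times the main scalar: `C_ijk = ¼ ∂̇_k ∂̇_i ∂̇_j F²`. -/
def fourMainScalar (T : TangentCalculus R) (F si e : R) : R :=
  e * F * ∑ i, ∑ j, ∑ k, T.Y k (T.Y i (T.Y j (F * F))) *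
    T.mvec F si e i * T.mvec F si e j * T.mvec F si e k

variable {F fi s si e : R}

namespace IsFrame

variable (h : T.IsFrame F fi s si e)
include h

lemma vert_e : T.vert F si e = 0 := by simp [vert_apply, h.Y_e]

lemma vert_fi : T.vert F si fi = 0 := by
  have := congrArg (T.vert F si) h.F_mul
  rw [Derivation.leibniz, vert_F] at this
  simp at this
  linear_combination fi * this - T.vert F si fi * h.F_mul

lemma vert_si : T.vert F si si = -(T.vert F si s * si) * si := by
  have := congrArg (T.vert F si) h.s_mul
  rw [Derivation.leibniz] at this
  simp at this
  linear_combination si * this - T.vert F si si * h.s_mul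

lemma wedge : T.y 0 * T.vert F si (T.y 1) - T.y 1 * T.vert F si (T.y 0) = F ^ 2 * si := by
  rw [vert_y0, vert_y1]
  linear_combination F * si * h.hess.euler

/-- The fibre coordinates solve `u'' + p u' + ε u = 0`, where `p = (log s)'`. -/
lemma vert_vert_y (i : Fin 2) : T.vert F si (T.vert F si (T.y i))
    = -e * T.y i - T.vert F si s * si * T.vert F si (T.y i) := by
  have h0 : T.vert F si (T.Y 0 F) = -(fi ^ 2 * e * s ^ 2 * si * F) * T.y 1 := by
    rw [vert_apply, T.Y1_Y0, h.hess.h00, h.hess.h01]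
    linear_combination (-(F * si * fi ^ 3 * e * s ^ 2 * T.y 1)) * h.hess.euler
      - (fi ^ 2 * e * s ^ 2 * si * F * T.y 1) * h.F_mul
  have h1 : T.vert F si (T.Y 1 F) = (fi ^ 2 * e * s ^ 2 * si * F) * T.y 0 := by
    rw [vert_apply, h.hess.h01, h.hess.h11]
    linear_combination ((F * si * fi ^ 3 * e * s ^ 2 * T.y 0)) * h.hess.euler
      + (fi ^ 2 * e * s ^ 2 * si * F * T.y 0) * h.F_mul
  have key : F * si * (fi ^ 2 * e * s ^ 2 * si * F) = e := by
    linear_combination e * (F * fi + 1) * h.F_mul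
      + F ^ 2 * fi ^ 2 * e * (s * si + 1) * h.s_mul
  fin_cases i
  · simp only [Fin.zero_eta, vert_y0, map_neg, Derivation.leibniz, h1, vert_F, h.vert_si,
      smul_eq_mul]
    linear_combination -T.y 0 * key
  · simp only [Fin.mk_one, vert_y1, Derivation.leibniz, h0, vert_F, h.vert_si, smul_eq_mul]
    linear_combination -T.y 1 * key

/-- `s_{;2} = ε 𝓘 s`. -/
lemma fourMainScalar_eq : T.fourMainScalar F si e = 4 * (e * (T.vert F si s * si)) := by
  -- `m^k ∂̇_k` kills `F`, so only the derivative of the coefficient of the Hessian survives.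
  have key : T.fourMainScalar F si e
      = 2 * F ^ 3 * si ^ 2 * T.vert F si (fi ^ 3 * (e * s ^ 2)) := by
    have H := h.hess
    generalize fi ^ 3 * (e * s ^ 2) = k at H
    simp only [fourMainScalar, mvec, Fin.sum_univ_two, Matrix.cons_val_zero, Matrix.cons_val_one,
      map_add, map_neg, Derivation.leibniz, Derivation.leibniz_pow, smul_eq_mul, nsmul_eq_mul,
      H.h00, H.h01, H.h11, T.Y1_Y0, T.Y0_y0, T.Y1_y1, T.Y0_y1, T.Y1_y0, vert_apply]
    push_cast
    linear_combination 2 * F ^ 2 * si ^ 3 * (T.Y 0 F * T.Y 1 k - T.Y 1 F * T.Y 0 k)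
      * (e ^ 4 * (T.y 0 * T.Y 0 F + T.y 1 * T.Y 1 F + F) * H.euler
        + F ^ 2 * (e ^ 2 + 1) * h.e_mul)
  have hf3 : F ^ 3 * fi ^ 3 = 1 := by rw [← mul_pow, h.F_mul, one_pow]
  rw [key]
  simp only [Derivation.leibniz, Derivation.leibniz_pow, smul_eq_mul, nsmul_eq_mul, h.vert_fi,
    h.vert_e]
  push_cast
  linear_combination 4 * e * si * T.vert F si s * (s * si * hf3 + h.s_mul)

/-- With `p = (log s)_{;2}`, the non-degeneracy factor is `φ_{;2;2} + p φ_{;2} + (φ_{;2})² + ε`. -/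
lemma nondegFactor_eq {φ : R} (hφ : T.IsHomog 0 φ) : T.nondegFactor F si e φ
    = T.vert F si (T.vert F si φ) + T.vert F si s * si * T.vert F si φ
      + T.vert F si φ ^ 2 + e := by
  have h0 := h.vert_vert_y 0
  have h1 := h.vert_vert_y 1
  have hφ' : T.y 0 * T.Y 0 φ + T.y 1 * T.Y 1 φ = 0 := by simpa [IsHomog] using hφ
  have hd : T.vert F si (T.vert F si φ) + T.vert F si s * si * T.vert F si φ
      = T.vert F si (T.y 0) * T.vert F si (T.Y 0 φ)
        + T.vert F si (T.y 1) * T.vert F si (T.Y 1 φ) := by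
    rw [vert_eq F si φ]
    simp only [map_add, Derivation.leibniz, smul_eq_mul, h0, h1]
    linear_combination (-e) * hφ'
  rw [hd]
  simp only [nondegFactor, mvec, Fin.sum_univ_two, Matrix.cons_val_zero, Matrix.cons_val_one,
    vert_apply, T.Y1_Y0, T.Y0_y0, T.Y1_y1,
    T.Y0_y1, T.Y1_y0]
  linear_combination (F ^ 2 * si ^ 2 * (T.Y 1 F ^ 2 * (T.Y 0 (T.Y 0 φ) + T.Y 0 φ * T.Y 0 φ)
    - 2 * (T.Y 0 F * T.Y 1 F) * (T.Y 0 (T.Y 1 φ) + T.Y 0 φ * T.Y 1 φ)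
    + T.Y 0 F ^ 2 * (T.Y 1 (T.Y 1 φ) + T.Y 1 φ * T.Y 1 φ))) * h.e_mul

/-- The fibre Hessian of `W F`, where `W = exp φ`. -/
lemma hasHessian_conformal {φ W : R} (hφ : T.IsHomog 0 φ) (hW : ∀ i, T.Y i W = W * T.Y i φ) :
    T.HasHessian (W * F) (fi ^ 3 * (s ^ 2 * W * T.nondegFactor F si e φ)) := by
  have hφ' : T.y 0 * T.Y 0 φ + T.y 1 * T.Y 1 φ = 0 := by simpa [IsHomog] using hφ
  have hom : T.IsHomog 1 (W * F) := by
    simp only [IsHomog, Derivation.leibniz, smul_eq_mul, hW]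
    push_cast
    linear_combination W * h.hess.euler + W * F * hφ'
  have := HasHessian.of_contract (n₀ := -T.Y 1 F) (n₁ := T.Y 0 F) hom h.F_mul
    (by linear_combination h.hess.euler) rfl
  convert this using 1
  simp only [nondegFactor, mvec, Fin.sum_univ_two, Matrix.cons_val_zero, Matrix.cons_val_one,
    map_add, Derivation.leibniz, smul_eq_mul, hW, h.hess.h00, h.hess.h01, h.hess.h11, T.Y1_Y0]
  linear_combination (W * F * fi ^ 2 * (T.Y 1 F ^ 2 * (T.Y 0 (T.Y 0 φ) + T.Y 0 φ * T.Y 0 φ)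
    - 2 * (T.Y 0 F * T.Y 1 F) * (T.Y 0 (T.Y 1 φ) + T.Y 0 φ * T.Y 1 φ)
    + T.Y 0 F ^ 2 * (T.Y 1 (T.Y 1 φ) + T.Y 1 φ * T.Y 1 φ)))
      * (s ^ 2 * si ^ 2 * e ^ 2 * h.F_mul + (s * si + 1) * e ^ 2 * h.s_mul + h.e_mul)
    - W * e * s ^ 2 * fi ^ 3 * ((fi * F + 1) * h.F_mul
      + fi ^ 2 * (T.y 0 * T.Y 0 F + T.y 1 * T.Y 1 F + F) * h.hess.euler)

lemma hess_mul : fi ^ 3 * (e * s ^ 2) * (F ^ 3 * (e * si ^ 2)) = 1 := by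
  have hf3 : F ^ 3 * fi ^ 3 = 1 := by rw [← mul_pow, h.F_mul, one_pow]
  linear_combination e ^ 2 * s ^ 2 * si ^ 2 * hf3 + e ^ 2 * (s * si + 1) * h.s_mul + h.e_mul

/-- `φ_{,1}` is the derivative of `φ` along the spray, divided by `F`. -/
lemma hor1_eq {G : Fin 2 → R} (hG : T.IsSpray F G) (φ : R) : T.hor1 fi G φ
    = fi * (T.y 0 * T.X 0 φ + T.y 1 * T.X 1 φ - 2 * (G 0 * T.Y 0 φ + G 1 * T.Y 1 φ)) := by
  have g0 := hG.isHomog h.hess h.F_mul h.hess_mul 0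
  have g1 := hG.isHomog h.hess h.F_mul h.hess_mul 1
  unfold IsHomog at g0 g1
  push_cast at g0 g1
  unfold hor1 hor
  linear_combination -fi * (T.Y 0 φ * g0 + T.Y 1 φ * g1)

/-- The change of the spray under an anisotropic conformal change, transversally to `y`: this
determines the coefficient `Q`. -/
lemma wedge_spray_conformal {φ W Wi : R} {G Gb : Fin 2 → R} (hφ : T.IsHomog 0 φ)
    (hWY : ∀ i, T.Y i W = W * T.Y i φ) (hWX : ∀ i, T.X i W = W * T.X i φ) (hW : W * Wi = 1)
    (hG : T.IsSpray F G) (hGb : T.IsSpray (W * F) Gb) :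
    2 * T.nondegFactor F si e φ * (T.y 0 * (Gb 1 - G 1) - T.y 1 * (Gb 0 - G 0))
      = F ^ 3 * si * (T.vert F si φ * T.hor1 fi G φ + T.vert F si (T.hor1 fi G φ)
        - 2 * T.hor2 F si e G φ) := by
  have Hb := h.hasHessian_conformal hφ hWY
  generalize T.nondegFactor F si e φ = K at Hb ⊢
  set k := fi ^ 3 * (s ^ 2 * W * K) with hk
  have hb : W * F * (Wi * fi) = 1 := by linear_combination F * fi * hW + h.F_mul
  set Ω := T.y 0 * (Gb 1 - G 1) - T.y 1 * (Gb 0 - G 0) with hΩ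
  set N' := (T.Y 0 F * T.Y 1 φ - T.Y 1 F * T.Y 0 φ) *
      (T.y 0 * T.X 0 φ + T.y 1 * T.X 1 φ - 2 * (G 0 * T.Y 0 φ + G 1 * T.Y 1 φ))
    + T.Y 0 F * T.Y 1 (T.y 0 * T.X 0 φ + T.y 1 * T.X 1 φ - 2 * (G 0 * T.Y 0 φ + G 1 * T.Y 1 φ))
    - T.Y 1 F * T.Y 0 (T.y 0 * T.X 0 φ + T.y 1 * T.X 1 φ - 2 * (G 0 * T.Y 0 φ + G 1 * T.Y 1 φ))
    - 2 * (T.Y 0 F * T.hor G 1 φ - T.Y 1 F * T.hor G 0 φ) with hN'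
  have hN : T.vert F si φ * T.hor1 fi G φ + T.vert F si (T.hor1 fi G φ)
      - 2 * T.hor2 F si e G φ = si * N' := by
    rw [h.hor1_eq hG, Derivation.leibniz, h.vert_fi, vert_apply, vert_apply, hor2, hN']
    simp only [mvec, Matrix.cons_val_zero, Matrix.cons_val_one, smul_eq_mul]
    generalize T.y 0 * T.X 0 φ + T.y 1 * T.X 1 φ - 2 * (G 0 * T.Y 0 φ + G 1 * T.Y 1 φ) = S
    linear_combination si * ((T.Y 0 F * T.Y 1 φ - T.Y 1 F * T.Y 0 φ) * S
      + T.Y 0 F * T.Y 1 S - T.Y 1 F * T.Y 0 S) * h.F_mul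
      - 2 * si * (T.Y 0 F * T.hor G 1 φ - T.Y 1 F * T.hor G 0 φ) * h.e_mul
  -- The geodesic equation of `W F`, contracted with `(-∂̇_1 F, ∂̇_0 F)`, minus the terms in `G`.
  have main : 2 * k * F * Ω = W * F * N' := by
    have g0 := hGb.geodesic Hb hb 0
    have g1 := hGb.geodesic Hb hb 1
    have f0 := hG.geodesic h.hess h.F_mul 0
    have f1 := hG.geodesic h.hess h.F_mul 1
    have f := hG.horizontal h.hess h.F_mul
    have b0 := Hb.h00
    have b1 := Hb.h01
    have b2 := Hb.h11
    rw [Hb.h00, Hb.h01] at g0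
    rw [T.Y1_Y0, Hb.h01, Hb.h11] at g1
    simp only [map_add, Derivation.leibniz, smul_eq_mul, hWY, hWX, T.Y1_Y0]
      at g0 g1 b0 b1 b2 f0 f1 f
    rw [hΩ, hN']
    simp only [hor, map_add, map_sub, Derivation.leibniz, smul_eq_mul, T.Y1_Y0, T.Y0_y0, T.Y1_y1,
      T.Y0_y1, T.Y1_y0, deriv_ofNat, ← T.X_Y]
    linear_combination T.Y 1 F * g0 - T.Y 0 F * g1
      - 2 * k * (T.y 0 * (Gb 1 - G 1) - T.y 1 * (Gb 0 - G 0)) * h.hess.euler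
      + 2 * (T.Y 0 F * (b1 * G 0 + b2 * G 1) - T.Y 1 F * (b0 * G 0 + b1 * G 1))
      + W * (T.Y 0 F * f1 - T.Y 1 F * f0)
      + W * (T.Y 0 F * T.Y 1 φ - T.Y 1 F * T.Y 0 φ) * f
  have hf3 : F ^ 3 * fi ^ 3 = 1 := by rw [← mul_pow, h.F_mul, one_pow]
  rw [hN]
  rw [hk] at main
  linear_combination Wi * F ^ 2 * si ^ 2 * main
    + (F ^ 3 * si ^ 2 * N' - 2 * K * Ω * F ^ 3 * fi ^ 3 * s ^ 2 * si ^ 2) * hW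
    - 2 * K * Ω * s ^ 2 * si ^ 2 * hf3 - 2 * K * Ω * (s * si + 1) * h.s_mul

end IsFrame

/-! ### Fourth fibre derivatives and the Douglas tensor -/

section Contraction

variable {D : Derivation ℝ R R} {v₀ v₁ e p : R}

/-- The fourth fibre derivative of `a`, contracted four times with `v`. -/
def quartic (T : TangentCalculus R) (v₀ v₁ a : R) : R :=
  v₀ ^ 4 * T.Y 0 (T.Y 0 (T.Y 0 (T.Y 0 a))) + 4 * (v₀ ^ 3 * v₁) * T.Y 0 (T.Y 0 (T.Y 0 (T.Y 1 a)))
    + 6 * (v₀ ^ 2 * v₁ ^ 2) * T.Y 0 (T.Y 0 (T.Y 1 (T.Y 1 a)))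
    + 4 * (v₀ * v₁ ^ 3) * T.Y 0 (T.Y 1 (T.Y 1 (T.Y 1 a)))
    + v₁ ^ 4 * T.Y 1 (T.Y 1 (T.Y 1 (T.Y 1 a)))

/-- The operator `D⁴ + ⋯` that computes `quartic` from the derivative along `v`. -/
def quarticOp (D : Derivation ℝ R R) (e p a : R) : R :=
  D (D (D (D a) + p * D a + 3 * e * a) + 2 * p * (D (D a) + p * D a + 3 * e * a)
    + 4 * e * D a) + 3 * p * (D (D (D a) + p * D a + 3 * e * a)
      + 2 * p * (D (D a) + p * D a + 3 * e * a) + 4 * e * D a)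
    + 3 * e * (D (D a) + p * D a + 3 * e * a)

/-- Each contraction with `v` of the next fibre derivative is a derivative along `D = v^i ∂̇_i`,
up to the terms that come from `D v^i = -ε y^i - p v^i`. -/
lemma quartic_eq {a : R} (ha : T.IsHomog 3 a) (hD : ∀ b, D b = v₀ * T.Y 0 b + v₁ * T.Y 1 b)
    (h0 : D v₀ = -e * T.y 0 - p * v₀) (h1 : D v₁ = -e * T.y 1 - p * v₁) :
    T.quartic v₀ v₁ a = quarticOp D e p a := by
  have s1 : D a = v₀ * T.Y 0 a + v₁ * T.Y 1 a := hD a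
  have s2 : D (D a) + p * D a + 3 * e * a = v₀ ^ 2 * T.Y 0 (T.Y 0 a)
      + 2 * (v₀ * v₁) * T.Y 0 (T.Y 1 a) + v₁ ^ 2 * T.Y 1 (T.Y 1 a) := by
    unfold IsHomog at ha
    push_cast at ha
    rw [s1]
    simp only [map_add, Derivation.leibniz, smul_eq_mul, h0, h1, hD (T.Y 0 a), hD (T.Y 1 a),
      T.Y1_Y0]
    linear_combination (-e) * ha
  have s3 : D (D (D a) + p * D a + 3 * e * a) + 2 * p * (D (D a) + p * D a + 3 * e * a)
      + 4 * e * D a = v₀ ^ 3 * T.Y 0 (T.Y 0 (T.Y 0 a))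
      + 3 * (v₀ ^ 2 * v₁) * T.Y 0 (T.Y 0 (T.Y 1 a))
      + 3 * (v₀ * v₁ ^ 2) * T.Y 0 (T.Y 1 (T.Y 1 a)) + v₁ ^ 3 * T.Y 1 (T.Y 1 (T.Y 1 a)) := by
    have k0 := ha.Y 0
    have k1 := ha.Y 1
    simp only [IsHomog, T.Y1_Y0] at k0 k1
    push_cast at k0 k1
    rw [s2, s1]
    simp only [map_add, Derivation.leibniz, Derivation.leibniz_pow, smul_eq_mul, nsmul_eq_mul, h0,
      h1, hD (T.Y _ (T.Y _ a)), T.Y1_Y0, deriv_ofNat]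
    push_cast
    linear_combination (-2 * e * v₀) * k0 + (-2 * e * v₁) * k1
  have k00 := (ha.Y 0).Y 0
  have k10 := (ha.Y 1).Y 0
  have k11 := (ha.Y 1).Y 1
  simp only [IsHomog, T.Y1_Y0] at k00 k10 k11
  push_cast at k00 k10 k11
  rw [quarticOp, s3, s2]
  simp only [map_add, Derivation.leibniz, Derivation.leibniz_pow, smul_eq_mul, nsmul_eq_mul, h0,
    h1, hD (T.Y _ (T.Y _ (T.Y _ a))), T.Y1_Y0, deriv_ofNat, quartic]
  push_cast
  linear_combination (3 * e * v₀ ^ 2) * k00 + (6 * e * (v₀ * v₁)) * k10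
    + (3 * e * v₁ ^ 2) * k11

/-- All fourth fibre derivatives of a function homogeneous of degree `3` are determined by the
single contraction `quartic`. -/
lemma wedge_pow_mul_fourth {a : R} (ha : T.IsHomog 3 a) (v₀ v₁ : R) (i j k l : Fin 2) :
    (T.y 0 * v₁ - T.y 1 * v₀) ^ 4 * T.Y i (T.Y j (T.Y k (T.Y l a)))
      = T.om i * T.om j * T.om k * T.om l * T.quartic v₀ v₁ a := by
  have key1 : ∀ i j k l, (T.y 0 * v₁ - T.y 1 * v₀) * T.Y i (T.Y j (T.Y k (T.Y l a)))
      = T.om i * (v₀ * T.Y 0 (T.Y j (T.Y k (T.Y l a)))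
        + v₁ * T.Y 1 (T.Y j (T.Y k (T.Y l a)))) := fun i j k l =>
    IsHomog.wedge_mul_Y (by simpa using ((ha.Y l).Y k).Y j) v₀ v₁ i
  have key2 : ∀ i j k l, (T.y 0 * v₁ - T.y 1 * v₀) * T.Y i (T.Y j (T.Y k (T.Y l a)))
      = T.om j * (v₀ * T.Y i (T.Y 0 (T.Y k (T.Y l a)))
        + v₁ * T.Y i (T.Y 1 (T.Y k (T.Y l a)))) := fun i j k l => by
    rw [T.Y_Y i j, T.Y_Y i 0, T.Y_Y i 1, key1]
  have key3 : ∀ i j k l, (T.y 0 * v₁ - T.y 1 * v₀) * T.Y i (T.Y j (T.Y k (T.Y l a)))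
      = T.om k * (v₀ * T.Y i (T.Y j (T.Y 0 (T.Y l a)))
        + v₁ * T.Y i (T.Y j (T.Y 1 (T.Y l a)))) := fun i j k l => by
    rw [T.Y_Y j k, T.Y_Y j 0, T.Y_Y j 1, key2]
  have key4 : ∀ i j k l, (T.y 0 * v₁ - T.y 1 * v₀) * T.Y i (T.Y j (T.Y k (T.Y l a)))
      = T.om l * (v₀ * T.Y i (T.Y j (T.Y k (T.Y 0 a)))
        + v₁ * T.Y i (T.Y j (T.Y k (T.Y 1 a)))) := fun i j k l => by
    rw [T.Y_Y k l, T.Y_Y k 0, T.Y_Y k 1, key3]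
  -- Exchange the four indices for contractions with `v`, one slot at a time.
  have e1 := key1 i j k l
  have e2 := fun b => key2 b j k l
  have e3 := fun b c => key3 b c k l
  have e4 := fun b c d => key4 b c d l
  have hq : T.quartic v₀ v₁ a = ∑ b, ∑ c, ∑ d, ∑ f, ![v₀, v₁] b * ![v₀, v₁] c * ![v₀, v₁] d
      * ![v₀, v₁] f * T.Y b (T.Y c (T.Y d (T.Y f a))) := by
    simp only [Fin.sum_univ_two, Matrix.cons_val_zero, Matrix.cons_val_one, T.Y1_Y0, quartic]
    ring
  rw [hq]
  simp only [Fin.sum_univ_two, Matrix.cons_val_zero, Matrix.cons_val_one]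
  generalize T.y 0 * v₁ - T.y 1 * v₀ = w at *
  linear_combination w ^ 3 * e1 + w ^ 2 * T.om i * (v₀ * e2 0 + v₁ * e2 1)
    + w * T.om i * T.om j * (v₀ * v₀ * e3 0 0 + v₀ * v₁ * e3 0 1 + v₁ * v₀ * e3 1 0
      + v₁ * v₁ * e3 1 1)
    + T.om i * T.om j * T.om k * (v₀ ^ 3 * e4 0 0 0 + v₀ ^ 2 * v₁ * (e4 0 0 1 + e4 0 1 0 + e4 1 0 0)
      + v₀ * v₁ ^ 2 * (e4 0 1 1 + e4 1 0 1 + e4 1 1 0) + v₁ ^ 3 * e4 1 1 1)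

end Contraction

section Douglas

/-- `F² ψ`, for given `P`, `Q` and main scalar `I`. -/
def psiNum (D : Derivation ℝ R R) (e I P Q : R) : R :=
  (-3 + D I) * e * Q + (1 + D I + 2 * e * I ^ 2) * e * D P + D (D (D P)) - 3 * D (D Q)
    + 3 * e * I * D (D P) - 3 * e * I * D Q + 2 * I * P

/-- `F² χ`, for given `P`, `Q` and main scalar `I`. -/
def chiNum (D : Derivation ℝ R R) (e I P Q : R) : R :=
  3 * P - (I + e * D (D I) + I * D I) * Q - (2 * e * D I + I ^ 2 - e) * D Q + 3 * e * D (D P)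
    + D (D (D Q)) + 3 * I * D P

/-- The function `P` drops out of `ε χ_{;2} + 2 𝓘 χ - 3 ψ`, which is a fourth order differential
operator in `Q`: that of the quartic contraction of `Q F / s`. -/
lemma quartic_eq_psi_chi {D : Derivation ℝ R R} {e p I Q u : R} (P : R) (he : e * e = 1)
    (hDe : D e = 0) (hp : p = e * I) (hu : D u = -p * u) :
    quarticOp D e p (u * Q)
      = u * e * (e * D (chiNum D e I P Q) + 2 * I * chiNum D e I P Q - 3 * psiNum D e I P Q) := by
  subst hp
  have s1 : D (u * Q) = u * (D Q - e * I * Q) := by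
    simp only [Derivation.leibniz, smul_eq_mul, hu]; ring
  have s2 : D (D (u * Q)) + e * I * D (u * Q) + 3 * e * (u * Q)
      = u * (D (D Q - e * I * Q) + 3 * e * Q) := by
    rw [s1, Derivation.leibniz, hu, smul_eq_mul, smul_eq_mul]; ring
  have s3 : D (u * (D (D Q - e * I * Q) + 3 * e * Q)) + 2 * (e * I) * (u * (D (D Q - e * I * Q)
      + 3 * e * Q)) + 4 * e * (u * (D Q - e * I * Q))
      = u * (D (D (D Q - e * I * Q) + 3 * e * Q) + e * I * (D (D Q - e * I * Q) + 3 * e * Q)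
        + 4 * e * (D Q - e * I * Q)) := by
    rw [Derivation.leibniz, hu, smul_eq_mul, smul_eq_mul]; ring
  have he' : e ^ 2 = 1 := by rw [sq, he]
  rw [quarticOp, s2, s1, s3]
  simp only [chiNum, psiNum, map_add, map_sub, Derivation.leibniz, Derivation.leibniz_pow,
    smul_eq_mul, nsmul_eq_mul, hu, hDe, deriv_ofNat, map_zero]
  push_cast
  linear_combination u * (-D (D (D (D Q))) + (2 * e * D I - e) * D (D Q)
    + (3 * e * D (D I) - 2 * e * I ^ 3) * D Q
    + (e * D (D (D I)) - 2 * e * I ^ 2 - 2 * e * I ^ 2 * D I) * Q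
    - 3 * e * D (D (D P)) + 6 * e * I ^ 2 * D P) * he'

lemma IsHomog.sub {n : ℤ} {a b : R} (ha : T.IsHomog n a) (hb : T.IsHomog n b) :
    T.IsHomog n (a - b) := by
  unfold IsHomog at *
  rw [map_sub, map_sub]
  linear_combination ha - hb

lemma IsHomog.wedge {a b : R} (ha : T.IsHomog 2 a) (hb : T.IsHomog 2 b) :
    T.IsHomog 3 (T.y 0 * a - T.y 1 * b) := by
  unfold IsHomog at *
  simp only [map_sub, Derivation.leibniz, smul_eq_mul, T.Y0_y0, T.Y1_y1, T.Y0_y1, T.Y1_y0]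
  push_cast at ha hb ⊢
  linear_combination T.y 0 * ha - T.y 1 * hb

/-- The coefficients `G^i - ⅓ (∂̇_s G^s) y^i` form a divergence-free field, with stream function
`⅓ (y⁰ G¹ - y¹ G⁰)`. -/
lemma projective_eq {G : Fin 2 → R} (hG : ∀ i, T.IsHomog 2 (G i)) {t : R} (ht : t * 3 = 1)
    (i : Fin 2) : G i - t * (T.Y 0 (G 0) + T.Y 1 (G 1)) * T.y i
      = ![-t * T.Y 1 (T.y 0 * G 1 - T.y 1 * G 0), t * T.Y 0 (T.y 0 * G 1 - T.y 1 * G 0)] i := by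
  have h0 := hG 0
  have h1 := hG 1
  unfold IsHomog at h0 h1
  push_cast at h0 h1
  fin_cases i <;>
    simp [T.Y0_y0, T.Y1_y1, T.Y0_y1, T.Y1_y0]
  · linear_combination -t * h0 - G 0 * ht
  · linear_combination -t * h1 - G 1 * ht

lemma third_projective_eq_zero {G : Fin 2 → R}
    (hB : ∀ i j k r, T.Y r (T.Y k (T.Y j (G i))) = 0) {t : R} (ht : ∀ i, T.Y i t = 0)
    (i j k r : Fin 2) :
    T.Y r (T.Y k (T.Y j (G i - t * (T.Y 0 (G 0) + T.Y 1 (G 1)) * T.y i))) = 0 := by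
  simp only [map_add, map_sub, Derivation.leibniz, smul_eq_mul, hB, ht, T.Y_y, map_zero, mul_zero,
    add_zero, zero_add, sub_self, apply_ite (T.Y _), Derivation.map_one_eq_zero, ite_self]

/-- With quadratic `G`, the Douglas tensor of `G + (a change of spray)` is the fourth fibre
derivative of the wedge `Ω` of the change with `y`. -/
lemma third_projective_eq {G Gb : Fin 2 → R} (hG : ∀ i, T.IsHomog 2 (G i))
    (hGb : ∀ i, T.IsHomog 2 (Gb i)) (hB : ∀ i j k r, T.Y r (T.Y k (T.Y j (G i))) = 0) {t : R}
    (ht : t * 3 = 1) (ht' : ∀ i, T.Y i t = 0) (i j k r : Fin 2) :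
    T.Y r (T.Y k (T.Y j (Gb i - t * (T.Y 0 (Gb 0) + T.Y 1 (Gb 1)) * T.y i)))
      = t * ![-T.Y r (T.Y k (T.Y j (T.Y 1 (T.y 0 * (Gb 1 - G 1) - T.y 1 * (Gb 0 - G 0))))),
          T.Y r (T.Y k (T.Y j (T.Y 0 (T.y 0 * (Gb 1 - G 1) - T.y 1 * (Gb 0 - G 0)))))] i := by
  have hsub : T.y 0 * (Gb 1 - G 1) - T.y 1 * (Gb 0 - G 0)
      = (T.y 0 * Gb 1 - T.y 1 * Gb 0) - (T.y 0 * G 1 - T.y 1 * G 0) := by ring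
  have hz := third_projective_eq_zero hB ht' i j k r
  rw [projective_eq hG ht] at hz
  rw [projective_eq hGb ht, hsub]
  generalize T.y 0 * Gb 1 - T.y 1 * Gb 0 = a at *
  generalize T.y 0 * G 1 - T.y 1 * G 0 = b at *
  fin_cases i <;>
    simp only [Fin.zero_eta, Fin.mk_one, Matrix.cons_val_zero, Matrix.cons_val_one, neg_mul,
      map_neg, map_sub, Derivation.leibniz, smul_eq_mul, ht', mul_zero, add_zero] at hz ⊢
  · linear_combination hz
  · linear_combination hz

/-- The Douglas tensor of the changed spray vanishes at a point if and only if the scalar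
condition on `ψ` and `χ` holds there. -/
theorem douglas_iff {F fi s si e φ W Wi ki t I P Q : R} {G Gb : Fin 2 → R}
    (h : T.IsFrame F fi s si e) (hφ : T.IsHomog 0 φ)
    (hWY : ∀ i, T.Y i W = W * T.Y i φ) (hWX : ∀ i, T.X i W = W * T.X i φ) (hW : W * Wi = 1)
    (hG : T.IsSpray F G) (hGb : T.IsSpray (W * F) Gb) (hK : T.nondegFactor F si e φ * ki = 1)
    (hB : ∀ i j k r, T.Y r (T.Y k (T.Y j (G i))) = 0) (ht : t * 3 = 1) (ht' : ∀ i, T.Y i t = 0)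
    (hI : 4 * I = T.fourMainScalar F si e)
    (hQ : 2 * Q = e * ki * F ^ 2 * (T.vert F si φ * T.hor1 fi G φ
      + T.vert F si (T.hor1 fi G φ) - 2 * T.hor2 F si e G φ))
    (ev : R →+* ℝ) :
    (∀ i j k r, ev (T.Y r (T.Y k (T.Y j (Gb i - t * (T.Y 0 (Gb 0) + T.Y 1 (Gb 1)) * T.y i)))) = 0)
      ↔ ev (e * T.vert F si (chiNum (T.vert F si) e I P Q) + 2 * I * chiNum (T.vert F si) e I P Q
          - 3 * psiNum (T.vert F si) e I P Q) = 0 := by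
  have hGh := hG.isHomog h.hess h.F_mul h.hess_mul
  have hf3 : F ^ 3 * fi ^ 3 = 1 := by rw [← mul_pow, h.F_mul, one_pow]
  have hs2 : s ^ 2 * si ^ 2 = 1 := by rw [← mul_pow, h.s_mul, one_pow]
  have hGbh := hGb.isHomog (h.hasHessian_conformal hφ hWY)
    (fi := Wi * fi) (hi := F ^ 3 * (si ^ 2 * Wi * ki))
    (by linear_combination F * fi * hW + h.F_mul)
    (by linear_combination (s ^ 2 * W * T.nondegFactor F si e φ * (si ^ 2 * Wi * ki)) * hf3
          + (W * T.nondegFactor F si e φ * Wi * ki) * hs2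
          + (T.nondegFactor F si e φ * ki) * hW + hK)
  set Ω := T.y 0 * (Gb 1 - G 1) - T.y 1 * (Gb 0 - G 0) with hΩ
  have hΩQ : Ω = e * F * si * Q := by
    apply two_mul_cancel
    have := h.wedge_spray_conformal hφ hWY hWX hW hG hGb
    rw [← hΩ] at this
    generalize T.vert F si φ * T.hor1 fi G φ
      + T.vert F si (T.hor1 fi G φ) - 2 * T.hor2 F si e G φ = N at *
    linear_combination ki * this - 2 * Ω * hK - e * F * si * hQ - ki * F ^ 3 * si * N * h.e_mul
  have hΩh : T.IsHomog 3 Ω := by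
    have : Ω = (T.y 0 * Gb 1 - T.y 1 * Gb 0) - (T.y 0 * G 1 - T.y 1 * G 0) := by rw [hΩ]; ring
    exact this ▸ ((hGbh 1).wedge (hGbh 0)).sub ((hGh 1).wedge (hGh 0))
  have hp : T.vert F si s * si = e * I := by
    have h4 : I = e * (T.vert F si s * si) := by
      apply two_mul_cancel
      apply two_mul_cancel
      linear_combination hI + h.fourMainScalar_eq
    linear_combination -e * h4 - T.vert F si s * si * h.e_mul
  have hu : T.vert F si (e * F * si) = -(T.vert F si s * si) * (e * F * si) := by
    simp only [Derivation.leibniz, smul_eq_mul, vert_F, h.vert_e, h.vert_si]; ring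
  have hq := quartic_eq hΩh (vert_eq F si) (h.vert_vert_y 0) (h.vert_vert_y 1)
  rw [hΩQ, quartic_eq_psi_chi P h.e_mul h.vert_e hp hu, ← hΩQ] at hq
  set Z := e * T.vert F si (chiNum (T.vert F si) e I P Q) + 2 * I * chiNum (T.vert F si) e I P Q
    - 3 * psiNum (T.vert F si) e I P Q
  have ev_ne : ∀ {a b : R}, a * b = 1 → ev a ≠ 0 := fun hab h0 => by
    have := congrArg ev hab
    simp [h0] at this
  have hF0 := ev_ne h.F_mul
  have he0 := ev_ne h.e_mul
  have hsi0 := ev_ne (a := si) (b := s) (by rw [mul_comm, h.s_mul])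
  have ht0 := ev_ne ht
  have hqZ : ev (T.quartic (T.vert F si (T.y 0)) (T.vert F si (T.y 1)) Ω) = 0 ↔ ev Z = 0 := by
    rw [hq]
    simp [hF0, he0, hsi0]
  have hD : ∀ i j k r,
      T.Y r (T.Y k (T.Y j (Gb i - t * (T.Y 0 (Gb 0) + T.Y 1 (Gb 1)) * T.y i)))
      = t * ![-T.Y r (T.Y k (T.Y j (T.Y 1 Ω))), T.Y r (T.Y k (T.Y j (T.Y 0 Ω)))] i :=
    third_projective_eq hGh hGbh hB ht ht'
  rw [← hqZ]
  constructor
  · intro hall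
    have h4 : ∀ i j k l, ev (T.Y i (T.Y j (T.Y k (T.Y l Ω)))) = 0 := by
      intro i j k l
      have a0 := hall 0 k j i
      have a1 := hall 1 k j i
      rw [hD] at a0 a1
      fin_cases l
      · simpa [ht0] using a1
      · simpa [ht0] using a0
    simp [quartic, h4]
  · intro h0 i j k r
    have h4 : ∀ i j k l, ev (T.Y i (T.Y j (T.Y k (T.Y l Ω)))) = 0 := by
      intro i j k l
      have := congrArg ev (wedge_pow_mul_fourth hΩh (T.vert F si (T.y 0)) (T.vert F si (T.y 1))
        i j k l)
      rw [h.wedge, map_mul, map_mul, h0, mul_zero] at this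
      simpa [hF0, hsi0] using this
    rw [hD]
    fin_cases i <;> simp [h4]

end Douglas

end TangentCalculus

open TopologicalSpace (Opens)

/-! ### The ring of smooth functions on an open set of the coordinate space -/

/-- The algebra of smooth functions on an open set of the coordinate space `(x, y)`. -/
def smoothFun (U : Opens (Plane × Plane)) : Subalgebra ℝ (U → ℝ) where
  carrier := {a | ∃ f : Plane × Plane → ℝ, ContDiffOn ℝ ∞ f U ∧ ∀ p : U, f p = a p}
  mul_mem' := by
    rintro a b ⟨f, hf, hfa⟩ ⟨g, hg, hgb⟩
    exact ⟨fun p => f p * g p, hf.mul hg, fun p => by simp [hfa, hgb]⟩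
  add_mem' := by
    rintro a b ⟨f, hf, hfa⟩ ⟨g, hg, hgb⟩
    exact ⟨fun p => f p + g p, hf.add hg, fun p => by simp [hfa, hgb]⟩
  algebraMap_mem' c := ⟨fun _ => c, contDiffOn_const, fun _ => rfl⟩

variable {U : Opens (Plane × Plane)}

/-- `f` restricts to the smooth function `a` on `U`. -/
def IsRep (f : Plane × Plane → ℝ) (a : smoothFun U) : Prop := ∀ p : U, f p = a.1 p

/-- The restriction to `U` of a function that is smooth there. -/
def toSmooth (f : Plane × Plane → ℝ) (hf : ContDiffOn ℝ ∞ f U) : smoothFun U :=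
  ⟨fun p => f p, f, hf, fun _ => rfl⟩

lemma isRep_toSmooth (f : Plane × Plane → ℝ) (hf : ContDiffOn ℝ ∞ f U) :
    IsRep f (toSmooth f hf) := fun _ => rfl

lemma exists_isRep (a : smoothFun U) : ∃ f, ContDiffOn ℝ ∞ f U ∧ IsRep f a := a.2

/-- Evaluation at a point. -/
def evalAt (p : U) : smoothFun U →+* ℝ :=
  (Pi.evalRingHom (fun _ : U => ℝ) p).comp (smoothFun U).val.toRingHom

lemma smoothFun_ext {a b : smoothFun U} (h : ∀ p, evalAt p a = evalAt p b) : a = b :=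
  Subtype.ext (funext h)

namespace IsRep

variable {f g : Plane × Plane → ℝ} {a b : smoothFun U}

lemma eval (hf : IsRep f a) (p : U) : evalAt p a = f p := (hf p).symm

lemma unique (hf : IsRep f a) (hg : IsRep f b) : a = b :=
  smoothFun_ext fun p => by rw [hf.eval, hg.eval]

lemma contDiffOn (hf : IsRep f a) : ContDiffOn ℝ ∞ f U := by
  obtain ⟨g, hg, hga⟩ := exists_isRep a
  exact hg.congr fun p hp => (hf ⟨p, hp⟩).trans (hga ⟨p, hp⟩).symm

lemma contDiffAt (hf : IsRep f a) (p : U) : ContDiffAt ℝ ∞ f p :=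
  hf.contDiffOn.contDiffAt (U.isOpen.mem_nhds p.2)

lemma differentiableAt (hf : IsRep f a) (p : U) : DifferentiableAt ℝ f p :=
  (hf.contDiffAt p).differentiableAt (by simp)

lemma add (hf : IsRep f a) (hg : IsRep g b) : IsRep (fun p => f p + g p) (a + b) :=
  fun p => by simp [hf p, hg p]

lemma mul (hf : IsRep f a) (hg : IsRep g b) : IsRep (fun p => f p * g p) (a * b) :=
  fun p => by simp [hf p, hg p]

lemma sub (hf : IsRep f a) (hg : IsRep g b) : IsRep (fun p => f p - g p) (a - b) :=
  fun p => by simp [hf p, hg p]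

lemma sum {f : Fin 2 → Plane × Plane → ℝ} {a : Fin 2 → smoothFun U} (h : ∀ i, IsRep (f i) (a i)) :
    IsRep (fun p => ∑ i, f i p) (∑ i, a i) := fun p => by
  simp [Fin.sum_univ_two, h 0 p, h 1 p]

lemma congr (hf : IsRep f a) (h : ∀ p, g p = f p) : IsRep g a := fun p => (h p).trans (hf p)

lemma neg (hf : IsRep f a) : IsRep (fun p => -f p) (-a) := fun p => by simp [hf p]

lemma pow (hf : IsRep f a) (n : ℕ) : IsRep (fun p => f p ^ n) (a ^ n) := fun p => by simp [hf p]

lemma const (c : ℝ) : IsRep (fun _ => c) (algebraMap ℝ (smoothFun U) c) := fun _ => rfl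

lemma ofNat (n : ℕ) [n.AtLeastTwo] : IsRep (fun _ => (ofNat(n) : ℝ)) (ofNat(n) : smoothFun U) :=
  fun _ => rfl

lemma one : IsRep (fun _ => 1) (1 : smoothFun U) := fun _ => rfl

lemma eventuallyEq (hf : IsRep f a) (hg : IsRep g a) (p : U) : f =ᶠ[nhds (p : Plane × Plane)] g :=
  Filter.eventuallyEq_of_mem (U.isOpen.mem_nhds p.2)
    fun q hq => (hf ⟨q, hq⟩).trans (hg ⟨q, hq⟩).symm

lemma contDiffOn_fderiv (hf : IsRep f a) (v : Plane × Plane) :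
    ContDiffOn ℝ ∞ (fun p => fderiv ℝ f p v) U :=
  (hf.contDiffOn.fderiv_of_isOpen U.isOpen (m := ∞) (by simp)).clm_apply contDiffOn_const

end IsRep

/-- The underlying map of `dirDeriv`. As `U` is open, the derivative on `U` does not depend on the
chosen extension of the function to the whole plane. -/
def dirDerivFun (v : Plane × Plane) (a : smoothFun U) : smoothFun U :=
  toSmooth (fun p => fderiv ℝ (exists_isRep a).choose p v)
    (IsRep.contDiffOn_fderiv (exists_isRep a).choose_spec.2 v)

lemma IsRep.dirDerivFun {f : Plane × Plane → ℝ} {a : smoothFun U} (hf : IsRep f a)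
    (v : Plane × Plane) : IsRep (fun p => fderiv ℝ f p v) (dirDerivFun v a) := fun p => by
  change fderiv ℝ f p v = fderiv ℝ (exists_isRep a).choose p v
  rw [(hf.eventuallyEq (exists_isRep a).choose_spec.2 p).fderiv_eq]

lemma dirDerivFun_add (v : Plane × Plane) (a b : smoothFun U) :
    dirDerivFun v (a + b) = dirDerivFun v a + dirDerivFun v b := by
  obtain ⟨f, -, hf⟩ := exists_isRep a
  obtain ⟨g, -, hg⟩ := exists_isRep b
  have h := (hf.add hg).dirDerivFun v
  refine smoothFun_ext fun p => ?_
  rw [map_add, h.eval, (hf.dirDerivFun v).eval, (hg.dirDerivFun v).eval,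
    fderiv_fun_add (hf.differentiableAt p) (hg.differentiableAt p)]
  rfl

lemma dirDerivFun_mul (v : Plane × Plane) (a b : smoothFun U) :
    dirDerivFun v (a * b) = a * dirDerivFun v b + b * dirDerivFun v a := by
  obtain ⟨f, -, hf⟩ := exists_isRep a
  obtain ⟨g, -, hg⟩ := exists_isRep b
  have h := (hf.mul hg).dirDerivFun v
  refine smoothFun_ext fun p => ?_
  rw [map_add, map_mul, map_mul, h.eval, (hf.dirDerivFun v).eval, (hg.dirDerivFun v).eval,
    fderiv_fun_mul (hf.differentiableAt p) (hg.differentiableAt p), hf.eval, hg.eval]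
  rfl

lemma dirDerivFun_smul (v : Plane × Plane) (c : ℝ) (a : smoothFun U) :
    dirDerivFun v (c • a) = c • dirDerivFun v a := by
  have hc := (IsRep.const (U := U) c).dirDerivFun v
  have h0 : dirDerivFun v (algebraMap ℝ (smoothFun U) c) = 0 := by
    refine smoothFun_ext fun p => ?_
    rw [hc.eval, map_zero]
    simp
  rw [Algebra.smul_def, dirDerivFun_mul, h0, mul_zero, add_zero, Algebra.smul_def]

/-- The derivative in the constant direction `v`. -/
def dirDeriv (v : Plane × Plane) : Derivation ℝ (smoothFun U) (smoothFun U) :=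
  Derivation.mk' ⟨⟨dirDerivFun v, dirDerivFun_add v⟩, dirDerivFun_smul v⟩ (dirDerivFun_mul v)

lemma IsRep.dirDeriv {f : Plane × Plane → ℝ} {a : smoothFun U} (hf : IsRep f a)
    (v : Plane × Plane) : IsRep (fun p => fderiv ℝ f p v) (dirDeriv v a) := hf.dirDerivFun v

lemma dirDeriv_comm (v w : Plane × Plane) (a : smoothFun U) :
    dirDeriv v (dirDeriv w a) = dirDeriv w (dirDeriv v a) := by
  obtain ⟨f, hf', hf⟩ := exists_isRep a
  refine IsRep.unique ((hf.dirDeriv w).dirDeriv v) fun p => ?_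
  have hd : DifferentiableAt ℝ (fderiv ℝ f) p :=
    ((hf.contDiffAt p).fderiv_right (m := ∞) (by simp)).differentiableAt
      (by simp)
  have hs : ∀ v w : Plane × Plane, fderiv ℝ (fun q => fderiv ℝ f q w) (p : Plane × Plane) v
      = fderiv ℝ (fderiv ℝ f) p v w := fun v w => by
    rw [fderiv_clm_apply hd (differentiableAt_const w)]
    simp
  have hsymm : IsSymmSndFDerivAt ℝ f p :=
    (hf.contDiffAt p).isSymmSndFDerivAt (by
      rw [minSmoothness_of_isRCLikeNormedField]
      exact WithTop.coe_le_coe.2 (le_top : (2 : ℕ∞) ≤ ⊤))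
  have h2 := (hf.dirDeriv v).dirDeriv w p
  beta_reduce at h2
  rw [hs] at h2 ⊢
  rw [← h2]
  exact hsymm v w

/-- The coordinate function `y^i`. -/
def coordY (U : Opens (Plane × Plane)) (i : Fin 2) : smoothFun U :=
  toSmooth (fun p => p.2 i) (by fun_prop)

lemma isRep_coordY (i : Fin 2) : IsRep (fun p => p.2 i) (coordY U i) := fun _ => rfl

lemma dirDeriv_coordY (v : Plane × Plane) (i : Fin 2) :
    dirDeriv v (coordY U i) = algebraMap ℝ (smoothFun U) (v.2 i) := by
  refine IsRep.unique ((isRep_coordY i).dirDeriv v) fun p => ?_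
  have : HasFDerivAt (fun p : Plane × Plane => p.2 i)
      ((EuclideanSpace.proj i : Plane →L[ℝ] ℝ).comp (ContinuousLinearMap.snd ℝ Plane Plane)) p :=
    ((EuclideanSpace.proj i : Plane →L[ℝ] ℝ).comp
      (ContinuousLinearMap.snd ℝ Plane Plane)).hasFDerivAt
  rw [this.fderiv]
  rfl

/-- The partial derivatives on an open set of the coordinate space. -/
def calculus (U : Opens (Plane × Plane)) : TangentCalculus (smoothFun U) where
  X i := dirDeriv (EuclideanSpace.single i 1, 0)
  Y i := dirDeriv (0, EuclideanSpace.single i 1)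
  y := coordY U
  X_Y _ _ _ := dirDeriv_comm _ _ _
  Y_Y _ _ _ := dirDeriv_comm _ _ _
  Y_y i j := by
    rw [dirDeriv_coordY]
    by_cases h : i = j
    · subst h; simp
    · simp [h, Ne.symm h]
  X_y i j := by rw [dirDeriv_coordY]; simp

lemma IsRep.dx {f : Plane × Plane → ℝ} {a : smoothFun U} (hf : IsRep f a) (i : Fin 2) :
    IsRep (dx i f) ((calculus U).X i a) := hf.dirDeriv _

lemma IsRep.dy {f : Plane × Plane → ℝ} {a : smoothFun U} (hf : IsRep f a) (i : Fin 2) :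
    IsRep (dy i f) ((calculus U).Y i a) := hf.dirDeriv _

lemma IsRep.y (i : Fin 2) : IsRep (fun p => p.2 i) ((calculus U).y i) := fun _ => rfl

/-- A smooth function without zeros is invertible. -/
lemma IsRep.inv {f : Plane × Plane → ℝ} {a : smoothFun U} (hf : IsRep f a)
    (h0 : ∀ p ∈ U, f p ≠ 0) : ∃ b : smoothFun U, a * b = 1 ∧ IsRep (fun p => (f p)⁻¹) b := by
  refine ⟨toSmooth (fun p => (f p)⁻¹) (hf.contDiffOn.inv h0), ?_, fun _ => rfl⟩
  exact IsRep.unique (hf.mul (isRep_toSmooth _ _)) fun p => mul_inv_cancel₀ (h0 p p.2)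

/-- Differentiating `f (x, c y) = c ^ r f (x, y)` at `c = 1`. -/
lemma IsRep.isHomog {f : Plane × Plane → ℝ} {a : smoothFun U} (hf : IsRep f a) (r : ℕ)
    (hom : ∀ p ∈ U, ∀ c : ℝ, 0 < c → f (p.1, c • p.2) = c ^ r * f p) :
    (calculus U).IsHomog r a := by
  refine IsRep.unique (((IsRep.y 0).mul (hf.dy 0)).add ((IsRep.y 1).mul (hf.dy 1))) fun p => ?_
  have h1 : HasDerivAt (fun c : ℝ => f ((p : Plane × Plane).1, c • (p : Plane × Plane).2))
      (fderiv ℝ f p (0, (p : Plane × Plane).2)) 1 := by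
    have hg : HasDerivAt (fun c : ℝ => ((p : Plane × Plane).1, c • (p : Plane × Plane).2))
        (0, (1 : ℝ) • (p : Plane × Plane).2) 1 :=
      (hasDerivAt_const _ _).prodMk ((hasDerivAt_id _).smul_const _)
    rw [one_smul] at hg
    refine HasFDerivAt.comp_hasDerivAt_of_eq (1 : ℝ) ?_ hg (y := (p : Plane × Plane)) (by simp)
    exact (hf.differentiableAt p).hasFDerivAt
  have h2 : HasDerivAt (fun c : ℝ => c ^ r * f p) (r * f p) 1 := by
    simpa using (hasDerivAt_pow r (1 : ℝ)).mul_const (f p)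
  have h3 := h1.unique (h2.congr_of_eventuallyEq
    (Filter.eventuallyEq_of_mem (Ioi_mem_nhds one_pos) fun c hc => hom p p.2 c hc))
  -- Euler's relation is the derivative in the vertical direction `(0, y)`.
  have hdec : ((0 : Plane), (p : Plane × Plane).2)
      = (p : Plane × Plane).2 0 • ((0 : Plane), EuclideanSpace.single (0 : Fin 2) (1 : ℝ))
        + (p : Plane × Plane).2 1 • ((0 : Plane), EuclideanSpace.single (1 : Fin 2) (1 : ℝ)) := by
    refine Prod.ext (by simp) ?_
    ext i
    fin_cases i <;> simp
  rw [hdec, map_add, map_smul, map_smul] at h3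
  refine h3.trans ?_
  rw [hf p]
  simp

/-! ### Metric, spray and frame as smooth functions -/

variable {F φ : Plane × Plane → ℝ}

section Metric

variable {a : smoothFun U}

lemma isRep_lagrangian (hF : IsRep F a) : IsRep (lagrangian F) (a * a) :=
  (hF.mul hF).congr fun _ => sq _

/-- The metric tensor `g_ij`, as a smooth function. -/
def metricElt (a : smoothFun U) (i j : Fin 2) : smoothFun U :=
  algebraMap ℝ _ (1 / 2) * (calculus U).Y i ((calculus U).Y j (a * a))

lemma isRep_metric (hF : IsRep F a) (i j : Fin 2) :
    IsRep (fun p => metric F p i j) (metricElt a i j) :=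
  (IsRep.const _).mul (((isRep_lagrangian hF).dy j).dy i)

lemma algebraMap_half : algebraMap ℝ (smoothFun U) (1 / 2) * 2 = 1 := by
  rw [← map_ofNat (algebraMap ℝ (smoothFun U)) 2, ← map_mul]; norm_num

lemma algebraMap_fourth : algebraMap ℝ (smoothFun U) (1 / 4) * 4 = 1 := by
  rw [← map_ofNat (algebraMap ℝ (smoothFun U)) 4, ← map_mul]; norm_num

lemma algebraMap_third : algebraMap ℝ (smoothFun U) (1 / 3) * 3 = 1 := by
  rw [← map_ofNat (algebraMap ℝ (smoothFun U)) 3, ← map_mul]; norm_num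

lemma metricElt_eq (a : smoothFun U) (i j : Fin 2) : metricElt a i j
    = a * (calculus U).Y i ((calculus U).Y j a) + (calculus U).Y i a * (calculus U).Y j a := by
  simp only [metricElt, Derivation.leibniz, smul_eq_mul, map_add]
  linear_combination (a * (calculus U).Y i ((calculus U).Y j a)
    + (calculus U).Y i a * (calculus U).Y j a) * algebraMap_half

/-- The determinant of `g_ij`, as a smooth function. -/
def detElt (a : smoothFun U) : smoothFun U :=
  metricElt a 0 0 * metricElt a 1 1 - metricElt a 0 1 * metricElt a 1 0

lemma detElt_eq (a : smoothFun U) : detElt a =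
    (a * (calculus U).Y 0 ((calculus U).Y 0 a) + (calculus U).Y 0 a * (calculus U).Y 0 a)
      * (a * (calculus U).Y 1 ((calculus U).Y 1 a) + (calculus U).Y 1 a * (calculus U).Y 1 a)
    - (a * (calculus U).Y 0 ((calculus U).Y 1 a) + (calculus U).Y 0 a * (calculus U).Y 1 a) ^ 2 :=
    by
  simp only [detElt, metricElt_eq, TangentCalculus.Y1_Y0]
  ring

lemma isRep_detMetric (hF : IsRep F a) : IsRep (detMetric F) (detElt a) :=
  (((isRep_metric hF 0 0).mul (isRep_metric hF 1 1)).sub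
    ((isRep_metric hF 0 1).mul (isRep_metric hF 1 0))).congr fun _ => Matrix.det_fin_two _

/-- Where `F` vanishes, `g_ij = (∂̇_i F)(∂̇_j F)` is degenerate. -/
lemma ne_zero_of_detMetric_ne_zero (hF : IsRep F a) (p : U) (h : detMetric F p ≠ 0) :
    F p ≠ 0 := by
  intro h0
  apply h
  rw [← (isRep_detMetric hF).eval p, detElt_eq]
  simp only [map_sub, map_add, map_mul, map_pow, hF.eval p, h0]
  ring

/-- The spray coefficients solve the linear system `4 g_li G^i = y^k ∂_k ∂̇_l F² - ∂_l F²`. -/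
lemma exists_isSpray (hF : IsRep F a) (hdet : ∀ p ∈ U, detMetric F p ≠ 0) :
    ∃ G : Fin 2 → smoothFun U, (∀ i, IsRep (spray F i) (G i)) ∧ (calculus U).IsSpray a G := by
  obtain ⟨di, hdi, rdi⟩ := (isRep_detMetric hF).inv hdet
  have rB := fun l => ((IsRep.sum fun k => (IsRep.y k).mul (((isRep_lagrangian hF).dy l).dx k)).sub
    ((isRep_lagrangian hF).dx l))
  set B : Fin 2 → smoothFun U := fun l => ∑ k, (calculus U).y k * (calculus U).X k
    ((calculus U).Y l (a * a)) - (calculus U).X l (a * a) with hB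
  have rm := isRep_metric hF
  have hm : ∀ i j, (calculus U).Y i ((calculus U).Y j (a * a)) = 2 * metricElt a i j := by
    intro i j
    rw [metricElt]
    linear_combination -((calculus U).Y i ((calculus U).Y j (a * a))) * algebraMap_half
  refine ⟨![algebraMap ℝ _ (1 / 4) * (di * (metricElt a 1 1 * B 0 - metricElt a 0 1 * B 1)),
      algebraMap ℝ _ (1 / 4) * (di * (metricElt a 0 0 * B 1 - metricElt a 1 0 * B 0))],
      fun i => ?_, fun l => ?_⟩
  · fin_cases i
    · refine ((IsRep.const _).mul (rdi.mul (((rm 1 1).mul (rB 0)).sub ((rm 0 1).mul (rB 1))))).congr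
        fun p => ?_
      simp [spray, Matrix.inv_def, Matrix.adjugate_fin_two, Fin.sum_univ_two, detMetric]
      ring
    · refine ((IsRep.const _).mul (rdi.mul (((rm 0 0).mul (rB 1)).sub ((rm 1 0).mul (rB 0))))).congr
        fun p => ?_
      simp [spray, Matrix.inv_def, Matrix.adjugate_fin_two, Fin.sum_univ_two, detMetric]
      ring
  · have hBl : B l = (calculus U).y 0 * (calculus U).X 0 ((calculus U).Y l (a * a))
        + (calculus U).y 1 * (calculus U).X 1 ((calculus U).Y l (a * a))
        - (calculus U).X l (a * a) := by simp [hB, Fin.sum_univ_two]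
    rw [← hBl, hm, hm]
    rw [detElt] at hdi
    have h4 := algebraMap_fourth (U := U)
    fin_cases l <;> simp only [Fin.zero_eta, Fin.mk_one, Matrix.cons_val_zero, Matrix.cons_val_one]
    · linear_combination (algebraMap ℝ (smoothFun U) (1 / 4) * 4) * B 0 * hdi + B 0 * h4
    · linear_combination (algebraMap ℝ (smoothFun U) (1 / 4) * 4) * B 1 * hdi + B 1 * h4

end Metric

section Frame

variable {a : smoothFun U}

/-- The quantities `1 / F`, `√(ε 𝔤)` and `ε` are smooth, and form the data of a modified Berwald
frame. -/
lemma exists_isFrame (hF : IsRep F a) (hhom : (calculus U).IsHomog 1 a)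
    (hdet : ∀ p ∈ U, detMetric F p ≠ 0) :
    ∃ fi s si e : smoothFun U, (calculus U).IsFrame a fi s si e ∧
      IsRep (fun p => (F p)⁻¹) fi ∧ IsRep (eps F) e ∧
      IsRep (fun p => (Real.sqrt (eps F p * detMetric F p))⁻¹) si := by
  obtain ⟨fi, hfi, rfi⟩ := hF.inv fun p hp => ne_zero_of_detMetric_ne_zero hF ⟨p, hp⟩ (hdet p hp)
  have habs : ∀ p, eps F p * detMetric F p = |detMetric F p| := fun p => by
    rcases lt_trichotomy (detMetric F p) 0 with h | h | h
    · simp [eps, Real.sign_of_neg h, abs_of_neg h]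
    · simp [h]
    · simp [eps, Real.sign_of_pos h, abs_of_pos h]
  have hd := isRep_detMetric hF
  have hsm : ContDiffOn ℝ ∞ (fun p => Real.sqrt (eps F p * detMetric F p)) U := by
    simp only [habs]
    intro p hp
    have h1 : ContDiffAt ℝ ∞ (fun p => |detMetric F p|) p :=
      (contDiffAt_abs (hdet p hp)).comp p (hd.contDiffAt ⟨p, hp⟩)
    exact (h1.sqrt (abs_ne_zero.2 (hdet p hp))).contDiffWithinAt
  have rs := isRep_toSmooth _ hsm
  set s := toSmooth _ hsm
  have hs0 : ∀ p ∈ U, Real.sqrt (eps F p * detMetric F p) ≠ 0 := fun p hp => by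
    rw [habs]; exact (Real.sqrt_pos.2 (abs_pos.2 (hdet p hp))).ne'
  obtain ⟨si, hsi, rsi⟩ := rs.inv hs0
  have re : IsRep (eps F) (detElt a * si ^ 2) := fun p => by
    rw [← hd.mul (rsi.pow 2) p]
    beta_reduce
    rw [inv_pow, Real.sq_sqrt (by rw [habs]; positivity), habs]
    rcases lt_or_gt_of_ne (hdet p p.2) with h | h
    · rw [eps, Real.sign_of_neg h, abs_of_neg h, inv_neg, mul_neg, mul_inv_cancel₀ h.ne]
    · rw [eps, Real.sign_of_pos h, abs_of_pos h, mul_inv_cancel₀ h.ne']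
  set e := detElt a * si ^ 2 with he
  -- `ε` is obtained as `𝔤 / s²`, so that it is smooth; its derivatives vanish because `ε² = 1`.
  have hee : e * e = 1 := IsRep.unique (re.mul re) fun p => by
    rcases lt_or_gt_of_ne (hdet p p.2) with h | h
    · simp [eps, Real.sign_of_neg h]
    · simp [eps, Real.sign_of_pos h]
  refine ⟨fi, s, si, e, ⟨hfi, hsi, hee, ?_, fun i => ?_⟩, rfi, re, rsi⟩
  · have hes : e * s ^ 2 = detElt a := by
      rw [he]; linear_combination detElt a * (s * si + 1) * hsi
    rw [hes]
    exact TangentCalculus.hasHessian_of_det hhom hfi (detElt_eq a).symm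
  · have h := congrArg ((calculus U).Y i) hee
    rw [Derivation.leibniz, Derivation.map_one_eq_zero, smul_eq_mul] at h
    refine TangentCalculus.two_mul_cancel ?_
    linear_combination e * h - 2 * (calculus U).Y i e * hee

end Frame

/-! ### The scalar invariants as smooth functions -/

section Reps

variable {a fi s si e ph : smoothFun U} {G : Fin 2 → smoothFun U}

/-- `a`, `fi`, `s`, `si`, `e` are the frame elements of the conic pseudo-Finsler metric `F`. -/
structure FrameRep (F : Plane × Plane → ℝ) (a fi s si e : smoothFun U) : Prop where
  frame : (calculus U).IsFrame a fi s si e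
  rF : IsRep F a
  rfi : IsRep (fun p => (F p)⁻¹) fi
  re : IsRep (eps F) e
  rsi : IsRep (fun p => (Real.sqrt (eps F p * detMetric F p))⁻¹) si

variable (h : FrameRep F a fi s si e)
include h

lemma isRep_mUp (i : Fin 2) : IsRep (mUp F i) ((calculus U).mvec a si e i) := by
  have h0 := (h.re.mul h.rsi).mul (h.rF.dy 1).neg
  have h1 := (h.re.mul h.rsi).mul (h.rF.dy 0)
  fin_cases i
  · exact h0.congr fun p => rfl
  · exact h1.congr fun p => rfl

lemma isRep_v2 {f : Plane × Plane → ℝ} {b : smoothFun U} (hf : IsRep f b) :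
    IsRep (v2 F f) ((calculus U).vert a si b) := by
  have := (h.re.mul h.rF).mul (IsRep.sum fun i => (hf.dy i).mul (isRep_mUp h i))
  have e1 : (calculus U).vert a si b = e * a * ∑ i, (calculus U).Y i b
      * (calculus U).mvec a si e i := by
    rw [TangentCalculus.vert_apply, Fin.sum_univ_two]
    simp only [TangentCalculus.mvec, Matrix.cons_val_zero, Matrix.cons_val_one]
    linear_combination -(a * si * ((calculus U).Y 0 a * (calculus U).Y 1 b
      - (calculus U).Y 1 a * (calculus U).Y 0 b)) * h.frame.e_mul
  rw [e1]
  exact this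

/-- The main scalar, as a smooth function. -/
def mainScalarElt (a si e : smoothFun U) : smoothFun U :=
  algebraMap ℝ _ (1 / 4) * (calculus U).fourMainScalar a si e

lemma isRep_mainScalar : IsRep (mainScalar F) (mainScalarElt a si e) := by
  have := (h.re.mul h.rF).mul (IsRep.sum fun i => IsRep.sum fun j => IsRep.sum fun k =>
    ((((IsRep.const (1 / 2)).mul ((isRep_metric h.rF i j).dy k)).mul (isRep_mUp h i)).mul
      (isRep_mUp h j)).mul (isRep_mUp h k))
  have hq : algebraMap ℝ (smoothFun U) (1 / 4)
      = algebraMap ℝ (smoothFun U) (1 / 2) * algebraMap ℝ (smoothFun U) (1 / 2) := by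
    rw [← map_mul]; norm_num
  refine fun p => (this p).trans (congrArg (fun b : smoothFun U => b.1 p) ?_)
  simp only [metricElt, Derivation.leibniz, Derivation.map_algebraMap, smul_eq_mul, mul_zero,
    add_zero, mainScalarElt, TangentCalculus.fourMainScalar, hq, Fin.sum_univ_two]
  ring

omit h in
lemma isRep_delta (hG : ∀ i, IsRep (spray F i) (G i)) {f : Plane × Plane → ℝ} {b : smoothFun U}
    (hf : IsRep f b) (i : Fin 2) : IsRep (delta F i f) ((calculus U).hor G i b) := by
  have := (hf.dx i).sub (IsRep.sum fun j => ((hG j).dy i).mul (hf.dy j))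
  rw [Fin.sum_univ_two] at this
  exact this

lemma isRep_h1 (hG : ∀ i, IsRep (spray F i) (G i)) {f : Plane × Plane → ℝ} {b : smoothFun U}
    (hf : IsRep f b) : IsRep (h1 F f) ((calculus U).hor1 fi G b) := by
  have := IsRep.sum fun i => (isRep_delta hG hf i).mul ((IsRep.y i).mul h.rfi)
  rw [Fin.sum_univ_two] at this
  exact this

lemma isRep_h2 (hG : ∀ i, IsRep (spray F i) (G i)) {f : Plane × Plane → ℝ} {b : smoothFun U}
    (hf : IsRep f b) : IsRep (h2 F f) ((calculus U).hor2 a si e G b) := by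
  have := h.re.mul (IsRep.sum fun i => (isRep_delta hG hf i).mul (isRep_mUp h i))
  rw [Fin.sum_univ_two] at this
  exact this

lemma isRep_nondegFactor (hφ : IsRep φ ph) : IsRep (fun p => F p ^ 2 * (∑ i, ∑ j,
      (dy i (dy j φ) p + dy i φ p * dy j φ p) * mUp F i p * mUp F j p) + eps F p)
    ((calculus U).nondegFactor a si e ph) :=
  ((h.rF.pow 2).mul (IsRep.sum fun i => IsRep.sum fun j => ((((hφ.dy j).dy i).add
    ((hφ.dy i).mul (hφ.dy j))).mul (isRep_mUp h i)).mul (isRep_mUp h j))).add h.re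

lemma vert_s_mul : (calculus U).vert a si s * si = e * mainScalarElt a si e := by
  rw [mainScalarElt, h.frame.fourMainScalar_eq]
  linear_combination -((calculus U).vert a si s * si) * h.frame.e_mul
    - (e * e * ((calculus U).vert a si s * si)) * algebraMap_fourth

lemma isRep_rho (hφ : IsRep φ ph) (hhom : (calculus U).IsHomog 0 ph)
    (hK : ∀ p ∈ U, F p ^ 2 * (∑ i, ∑ j,
      (dy i (dy j φ) p + dy i φ p * dy j φ p) * mUp F i p * mUp F j p) + eps F p ≠ 0) :
    ∃ ki : smoothFun U, (calculus U).nondegFactor a si e ph * ki = 1 ∧ IsRep (rho F φ) ki := by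
  obtain ⟨ki, hki, rki⟩ := (isRep_nondegFactor h hφ).inv hK
  refine ⟨ki, hki, fun p => (rki p).symm.trans ?_ |>.symm⟩
  have h1 := isRep_v2 h hφ
  have hσ := ((isRep_v2 h h1).add ((h.re.mul (isRep_mainScalar h)).mul h1)).add
    ((IsRep.ofNat 2).mul (h1.pow 2))
  have hs : IsRep (fun p => sigma F φ p + eps F p - v2 F φ p ^ 2)
      ((calculus U).nondegFactor a si e ph) := by
    rw [h.frame.nondegFactor_eq hhom, vert_s_mul h]
    intro p
    refine ((hσ.add h.re).sub (h1.pow 2) p).trans (congrArg (fun b : smoothFun U => b.1 p) ?_)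
    ring
  rw [rho, one_div]
  exact congrArg Inv.inv ((isRep_nondegFactor h hφ p).trans (hs p).symm)

section PQ

variable {ki : smoothFun U} (hG : ∀ i, IsRep (spray F i) (G i)) (hφ : IsRep φ ph)
  (hρ : IsRep (rho F φ) ki)
include hG hφ hρ

lemma exists_isRep_Q : ∃ q : smoothFun U, IsRep (Q F φ) q ∧
    2 * q = e * ki * a ^ 2 * ((calculus U).vert a si ph * (calculus U).hor1 fi G ph
      + (calculus U).vert a si ((calculus U).hor1 fi G ph)
      - 2 * (calculus U).hor2 a si e G ph) := by
  have h1 := isRep_v2 h hφ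
  have hh := isRep_h1 h hG hφ
  refine ⟨_, (IsRep.const (1 / 2)).mul (((h.re.mul hρ).mul (h.rF.pow 2)).mul
    (((h1.mul hh).add (isRep_v2 h hh)).sub ((IsRep.ofNat 2).mul (isRep_h2 h hG hφ)))), ?_⟩
  rw [← mul_assoc, mul_comm 2, algebraMap_half, one_mul]

lemma exists_isRep_P : ∃ q : smoothFun U, IsRep (P F φ) q := by
  have h1 := isRep_v2 h hφ
  have hh := isRep_h1 h hG hφ
  exact ⟨_, (IsRep.const (1 / 2)).mul ((((hρ.neg.mul (h.rF.pow 2)).mul h1).mul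
    (((h1.mul hh).add (isRep_v2 h hh)).sub ((IsRep.ofNat 2).mul (isRep_h2 h hG hφ)))).add
    ((h.rF.pow 2).mul hh))⟩

end PQ

section PsiChi

open TangentCalculus (psiNum chiNum)

variable {P' Q' : smoothFun U} (hP : IsRep (P F φ) P') (hQ : IsRep (Q F φ) Q')
include hP hQ

lemma isRep_psi : IsRep (psi F φ)
    (psiNum ((calculus U).vert a si) e (mainScalarElt a si e) P' Q' * fi ^ 2) := by
  have hI := isRep_mainScalar h
  have hI1 := isRep_v2 h hI
  have hP1 := isRep_v2 h hP
  have hP2 := isRep_v2 h hP1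
  have hP3 := isRep_v2 h hP2
  have hQ1 := isRep_v2 h hQ
  have hQ2 := isRep_v2 h hQ1
  have n3 : IsRep (U := U) (fun _ => (-3 : ℝ)) (-3) := (IsRep.ofNat 3).neg
  have t1 := ((n3.add hI1).mul h.re).mul hQ
  have t2 := (((IsRep.one.add hI1).add (((IsRep.ofNat 2).mul h.re).mul (hI.pow 2))).mul
    h.re).mul hP1
  have t3 := (IsRep.ofNat 3).mul hQ2
  have t4 := (((IsRep.ofNat 3).mul h.re).mul hI).mul hP2
  have t5 := (((IsRep.ofNat 3).mul h.re).mul hI).mul hQ1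
  have t6 := ((IsRep.ofNat 2).mul hI).mul hP
  refine (((((((t1.add t2).add hP3).sub t3).add t4).sub t5).add t6).mul (h.rfi.pow 2)).congr
    fun p => ?_
  rw [psi, div_eq_mul_inv, inv_pow]

lemma isRep_chi : IsRep (chi F φ)
    (chiNum ((calculus U).vert a si) e (mainScalarElt a si e) P' Q' * fi ^ 2) := by
  have hI := isRep_mainScalar h
  have hI1 := isRep_v2 h hI
  have hI2 := isRep_v2 h hI1
  have hP1 := isRep_v2 h hP
  have hP2 := isRep_v2 h hP1
  have hQ1 := isRep_v2 h hQ
  have hQ2 := isRep_v2 h hQ1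
  have hQ3 := isRep_v2 h hQ2
  have t1 := (IsRep.ofNat 3).mul hP
  have t2 := ((hI.add (h.re.mul hI2)).add (hI.mul hI1)).mul hQ
  have t3 := (((((IsRep.ofNat 2).mul h.re).mul hI1).add (hI.pow 2)).sub h.re).mul hQ1
  have t4 := ((IsRep.ofNat 3).mul h.re).mul hP2
  have t5 := ((IsRep.ofNat 3).mul hI).mul hP1
  refine ((((((t1.sub t2).sub t3).add t4).add hQ3).add t5).mul (h.rfi.pow 2)).congr fun p => ?_
  rw [chi, div_eq_mul_inv, inv_pow]

end PsiChi

end Reps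

/-- In a given coordinate system, the Douglas tensor of `e^φ F` vanishes at a point if and only if
the scalar equation holds at that point. -/
theorem douglas_iff_of_coord (hF : ContDiffOn ℝ ∞ F U) (hφ : ContDiffOn ℝ ∞ φ U)
    (hFhom : ∀ p ∈ U, ∀ c : ℝ, 0 < c → F (p.1, c • p.2) = c ^ 1 * F p)
    (hφhom : ∀ p ∈ U, ∀ c : ℝ, 0 < c → φ (p.1, c • p.2) = c ^ 0 * φ p)
    (hdet : ∀ p ∈ U, detMetric F p ≠ 0)
    (hK : ∀ p ∈ U, F p ^ 2 * (∑ i, ∑ j,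
      (dy i (dy j φ) p + dy i φ p * dy j φ p) * mUp F i p * mUp F j p) + eps F p ≠ 0)
    (hB : ∀ p ∈ U, ∀ i j k r, berwaldCurvature F i j k r p = 0) (p : U) :
    (∀ i j k r, douglasTensor (fun q => Real.exp (φ q) * F q) i j k r p = 0) ↔
      3 * psi F φ p = eps F p * v2 F (chi F φ) p + 2 * mainScalar F p * chi F φ p := by
  have rF := isRep_toSmooth F hF
  have rφ := isRep_toSmooth φ hφ
  set a := toSmooth F hF
  set ph := toSmooth φ hφ
  have ha : (calculus U).IsHomog 1 a := by simpa using rF.isHomog 1 hFhom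
  have hph : (calculus U).IsHomog 0 ph := by simpa using rφ.isHomog 0 hφhom
  obtain ⟨fi, s, si, e, hfr, rfi, re, rsi⟩ := exists_isFrame rF ha hdet
  have h : FrameRep F a fi s si e := ⟨hfr, rF, rfi, re, rsi⟩
  obtain ⟨ki, hki, rki⟩ := isRep_rho h rφ hph hK
  obtain ⟨G, rG, hG⟩ := exists_isSpray rF hdet
  -- the conformal factor `W = exp φ`
  have rW := isRep_toSmooth (U := U) (fun q => Real.exp (φ q)) hφ.exp
  set W := toSmooth (U := U) (fun q => Real.exp (φ q)) hφ.exp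
  obtain ⟨Wi, hWi, -⟩ := rW.inv fun p _ => (Real.exp_pos _).ne'
  have hWd : ∀ v, dirDeriv v W = W * dirDeriv v ph := fun v =>
    IsRep.unique (rW.dirDeriv v) fun p => by
      rw [← (rW.mul (rφ.dirDeriv v)) p, fderiv_exp (rφ.differentiableAt p)]
      simp
  have hWY : ∀ i, (calculus U).Y i W = W * (calculus U).Y i ph := fun i => hWd _
  have hWX : ∀ i, (calculus U).X i W = W * (calculus U).X i ph := fun i => hWd _
  -- the changed metric is again non-degenerate
  have rFb := rW.mul rF
  have ev_ne : ∀ {x y : smoothFun U} (q : U), x * y = 1 → evalAt q x ≠ 0 := fun q hxy h0 => by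
    have := congrArg (evalAt q) hxy
    rw [map_mul, h0, zero_mul, map_one] at this
    exact zero_ne_one this
  have hdetb : ∀ q ∈ U, detMetric (fun q => Real.exp (φ q) * F q) q ≠ 0 := fun q hq => by
    rw [← (isRep_detMetric rFb).eval ⟨q, hq⟩, detElt_eq, (hfr.hasHessian_conformal hph hWY).det]
    simp only [map_mul, map_pow]
    have h1 := ev_ne ⟨q, hq⟩ hWi
    have h2 := ev_ne ⟨q, hq⟩ hfr.F_mul
    have h3 := ev_ne ⟨q, hq⟩ ((mul_comm fi a).trans hfr.F_mul)
    have h4 := ev_ne ⟨q, hq⟩ hfr.s_mul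
    have h5 := ev_ne ⟨q, hq⟩ hki
    positivity
  obtain ⟨Gb, rGb, hGb⟩ := exists_isSpray rFb hdetb
  have hB' : ∀ i j k r, (calculus U).Y r ((calculus U).Y k ((calculus U).Y j (G i))) = 0 :=
    fun i j k r => IsRep.unique ((((rG i).dy j).dy k).dy r) fun q => hB q q.2 i j k r
  obtain ⟨q, rq, hq⟩ := exists_isRep_Q h rG rφ rki
  obtain ⟨q', rq'⟩ := exists_isRep_P h rG rφ rki
  have main := TangentCalculus.douglas_iff (P := q') (t := algebraMap ℝ _ (1 / 3))
    (I := mainScalarElt a si e) hfr hph hWY hWX hWi hG hGb hki hB' algebraMap_third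
    (fun i => Derivation.map_algebraMap _ _)
    (by rw [mainScalarElt, ← mul_assoc, mul_comm 4, algebraMap_fourth, one_mul]) hq (evalAt p)
  have rD : ∀ i j k r, IsRep (douglasTensor (fun q => Real.exp (φ q) * F q) i j k r)
      ((calculus U).Y r ((calculus U).Y k ((calculus U).Y j (Gb i - algebraMap ℝ _ (1 / 3)
        * ((calculus U).Y 0 (Gb 0) + (calculus U).Y 1 (Gb 1)) * (calculus U).y i)))) :=
    fun i j k r => by
      have := ((rGb i).sub (((IsRep.const (1 / 3)).mul
        (IsRep.sum fun s => (rGb s).dy s)).mul (IsRep.y i)))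
      rw [Fin.sum_univ_two] at this
      exact ((this.dy j).dy k).dy r
  simp only [(rD _ _ _ _).eval p] at main
  rw [main]
  have hψ := isRep_psi h rq' rq
  have hχ := isRep_chi h rq' rq
  rw [← hψ.eval p, ← (isRep_v2 h hχ).eval p, ← hχ.eval p, ← re.eval p,
    ← (isRep_mainScalar h).eval p]
  generalize TangentCalculus.psiNum ((calculus U).vert a si) e (mainScalarElt a si e) q' q = ψ
  generalize TangentCalculus.chiNum ((calculus U).vert a si) e (mainScalarElt a si e) q' q = χ
  -- `(1 / F)_{;2} = 0`, so that the factor `1 / F²` of `ψ` and `χ` can be divided out.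
  have hv : (calculus U).vert a si (χ * fi ^ 2) = (calculus U).vert a si χ * fi ^ 2 := by
    rw [Derivation.leibniz, Derivation.leibniz_pow, hfr.vert_fi]
    simp [mul_comm]
  rw [hv]
  simp only [map_mul, map_sub, map_add, map_pow, map_ofNat]
  have h3 := ev_ne p ((mul_comm fi a).trans hfr.F_mul)
  have h4 : (evalAt p fi) ^ 2 ≠ 0 := pow_ne_zero 2 h3
  constructor
  · intro h0
    linear_combination -(evalAt p fi) ^ 2 * h0
  · intro h0
    refine (mul_eq_zero.1 (?_ : (evalAt p fi) ^ 2 * _ = 0)).resolve_left h4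
    linear_combination -h0

/-! ### Charts of the surface -/

section Chart

variable {M : Type*} [TopologicalSpace M] [ChartedSpace Plane M] [IsManifold (𝓡 2) ∞ M]
  {e : OpenPartialHomeomorph M Plane}

lemma contMDiff_tangentModel :
    ContMDiff 𝓘(ℝ, Plane × Plane) (𝓡 2).tangent ∞
      (fun p : Plane × Plane => (⟨p.1, p.2⟩ : TangentBundle (𝓡 2) Plane)) := by
  have := contMDiff_tangentBundleModelSpaceHomeomorph_symm (I := 𝓡 2) (n := ∞)
  rw [modelWithCornersSelf_prod]
  exact this

lemma contMDiffOn_ofCoord (he : e ∈ IsManifold.maximalAtlas (𝓡 2) ∞ M) :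
    ContMDiffOn 𝓘(ℝ, Plane × Plane) (𝓡 2).tangent ∞ (ofCoord e) (Prod.fst ⁻¹' e.target) := by
  have hs := contMDiffOn_symm_of_mem_maximalAtlas he
  have ht := hs.contMDiffOn_tangentMapWithin (m := ∞) (by simp) e.open_target.uniqueMDiffOn
  have heq : ∀ p ∈ (Prod.fst ⁻¹' e.target : Set (Plane × Plane)), ofCoord e p
      = tangentMapWithin (𝓡 2) (𝓡 2) e.symm e.target (⟨p.1, p.2⟩ : TangentBundle (𝓡 2) Plane) := by
    intro p hp
    have hd : MDifferentiableAt (𝓡 2) (𝓡 2) e.symm p.1 :=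
      (contMDiffAt_symm_of_mem_maximalAtlas he hp).mdifferentiableAt (by simp)
    have hu : UniqueMDiffWithinAt (𝓡 2) e.target p.1 := e.open_target.uniqueMDiffWithinAt hp
    rw [tangentMapWithin_eq_tangentMap (p := (⟨p.1, p.2⟩ : TangentBundle (𝓡 2) Plane)) hu hd,
      ofCoord]
  have hc := ht.comp (contMDiff_tangentModel.contMDiffOn (s := Prod.fst ⁻¹' e.target))
    (fun p hp => hp)
  exact hc.congr heq

lemma isOpen_coordDomain (he : e ∈ IsManifold.maximalAtlas (𝓡 2) ∞ M)
    {A : Set (TangentBundle (𝓡 2) M)} (hA : IsOpen A) : IsOpen (coordDomain e A) :=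
  (contMDiffOn_ofCoord he).continuousOn.isOpen_inter_preimage
    (e.open_target.preimage continuous_fst) hA

lemma contDiffOn_coordRep (he : e ∈ IsManifold.maximalAtlas (𝓡 2) ∞ M)
    {A : Set (TangentBundle (𝓡 2) M)} {f : TangentBundle (𝓡 2) M → ℝ}
    (hf : ContMDiffOn (𝓡 2).tangent 𝓘(ℝ, ℝ) ∞ f A) :
    ContDiffOn ℝ ∞ (coordRep e f) (coordDomain e A) :=
  contMDiffOn_iff_contDiffOn.1 (hf.comp ((contMDiffOn_ofCoord he).mono fun _ hp => hp.1)
    fun _ hp => hp.2)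

omit [IsManifold (𝓡 2) ∞ M] in
lemma ofCoord_smul (p : Plane × Plane) (c : ℝ) : ofCoord e (p.1, c • p.2)
    = (⟨(ofCoord e p).proj, c • (ofCoord e p).snd⟩ : TangentBundle (𝓡 2) M) := by
  simp only [ofCoord, tangentMap]
  congr 1
  exact map_smul _ c _

omit [IsManifold (𝓡 2) ∞ M] in
lemma coordRep_smul {A : Set (TangentBundle (𝓡 2) M)} {f : TangentBundle (𝓡 2) M → ℝ} {r : ℕ}
    (hf : IsHomogeneousOn A r f) (p : Plane × Plane) (hp : p ∈ coordDomain e A) (c : ℝ)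
    (hc : 0 < c) : coordRep e f (p.1, c • p.2) = c ^ r * coordRep e f p := by
  rw [coordRep, ofCoord_smul]
  exact hf _ hp.2 c hc

end Chart

end FinslerSurface

end

theorem mainTheorem5 {M : Type*} [TopologicalSpace M] [ChartedSpace FinslerSurface.Plane M]
    [IsManifold (𝓡 2) ∞ M]
    (A : Set (TangentBundle (𝓡 2) M)) (F φ : TangentBundle (𝓡 2) M → ℝ)
    (hF : FinslerSurface.IsConicPseudoFinsler A F)
    (hB : FinslerSurface.IsBerwald A F)
    (hφ : FinslerSurface.IsAnisotropicConformalFactor A F φ) :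
    FinslerSurface.IsDouglas A (FinslerSurface.conformalChange φ F) ↔
      ∀ e ∈ IsManifold.maximalAtlas (𝓡 2) ∞ M, ∀ p ∈ FinslerSurface.coordDomain e A,
        3 * FinslerSurface.psi (FinslerSurface.coordRep e F) (FinslerSurface.coordRep e φ) p =
          FinslerSurface.eps (FinslerSurface.coordRep e F) p *
              FinslerSurface.v2 (FinslerSurface.coordRep e F)
                (FinslerSurface.chi (FinslerSurface.coordRep e F) (FinslerSurface.coordRep e φ)) p
            + 2 * FinslerSurface.mainScalar (FinslerSurface.coordRep e F) p *
              FinslerSurface.chi (FinslerSurface.coordRep e F) (FinslerSurface.coordRep e φ) p := by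

  have key := fun e (he : e ∈ IsManifold.maximalAtlas (𝓡 2) ∞ M) p
    (hp : p ∈ FinslerSurface.coordDomain e A) => FinslerSurface.douglas_iff_of_coord
      (U := ⟨_, FinslerSurface.isOpen_coordDomain he hF.conic.isOpen⟩)
      (FinslerSurface.contDiffOn_coordRep he hF.smooth)
      (FinslerSurface.contDiffOn_coordRep he hφ.smooth)
      (FinslerSurface.coordRep_smul hF.homogeneous) (FinslerSurface.coordRep_smul hφ.homogeneous)
      (hF.nondegenerate e he) (hφ.nondegenerate e he) (hB e he) ⟨p, hp⟩
  exact ⟨fun h e he p hp => (key e he p hp).1 (h e he p hp),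
    fun h e he p hp => (key e he p hp).2 (h e he p hp)⟩
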